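/- Let $\mathbb{K}=\mathbb{R}$ or $\mathbb{K}=\mathbb{C}$ and $\mathbb{N}=\{1,2,3,\ldots\}$. A finite set $F\subset\mathbb{N}$ is a Schreier set if $F=\emptyset$ or $|F|\le\min F$; a Schreier chain is a non-empty finite collection $\mathcal{C}=\{F_1<F_2<\cdots<F_m\}$ of non-empty Schreier sets, where $F<G$ means $\max F<\min G$. For $1\le p<\infty$, the $p$-convexified Schreier space $S_p$ is the closed linear span of the unit vectors $(e_n)_{n\in\mathbb{N}}$ in the Banach space of all $x\in\mathbb{K}^{\mathbb{N}}$ for which $$\|x\|_{S_p}=\sup\Bigl\{\Bigl(\sum_{n\in F}|x(n)|^p\Bigr)^{1/p} : F \text{ is a Schreier set}\Bigr\}<\infty .$$ For $1<p<\infty$, the Baernstein space $B_p$ is the Banach space of all $x\in\mathbb{K}^{\mathbb{N}}$ for which $$\|x\|_{B_p}=\sup\Bigl\{\Bigl(\sum_{F\in\mathcal{C}}\Bigl(\sum_{n\in F}|x(n)|\Bigr)^p\Bigr)^{1/p} : \mathcal{C} \text{ is a Schreier chain}\Bigr\}<\infty .$$ An operator (bounded linear map) is strictly singular if its restriction to any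 infinite-dimensional subspace fails to be an isomorphic embedding. Let $E=B_p$ for some $1<p<\infty$ or $E=S_p$ for some $1\le p<\infty$. (1) If $T$ and $U$ are strictly singular operators on $E$, then the composite operator $TU$ is compact. (2) Consequently, among the small ideals, only the ideal of compact operators has an approximate identity. More precisely, let $I\ne\{0\}$ be a closed two-sided ideal of the algebra of bounded operators on $E$ consisting of strictly singular operators. If $I$ has a left or a right approximate identity (that is, there is a net $(A_\alpha)$ in $I$, not necessarily bounded, such that $\|A_\alpha T-T\|\to0$ for every $T\in I$, or such that $\|TA_\alpha-T\|\to0$ for every $T\in I$), then $I$ is the ideal of compact operators on $E$. On the other hand, the ideal of compact operators on $E$ does have an approximate identity, which can be chosen two-sided and contractive (that is, with $\|A_\alpha\|\le1$ for all $\alpha$). -/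

import Mathlib

open Filter Topology

noncomputable section

namespace SchreierBaernstein

/-! Sequences are indexed by `ℕ = {0, 1, 2, …}`; the index `n` stands for the `(n + 1)`-st
coordinate. So a finite set `F` of indices represents the set `{n + 1 : n ∈ F}` of positive
integers, whose minimum is `min F + 1`. -/

/-- Schreier sets: `F = ∅` or `|F| ≤ min {n + 1 : n ∈ F}`. -/
def IsSchreier (F : Finset ℕ) : Prop :=
  ∀ n ∈ F, F.card ≤ n + 1

/-- Schreier chains: non-empty finite collections of non-empty Schreier sets that are consecutive,
i.e. of any two distinct members, one lies entirely to the left of the other. -/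
structure IsSchreierChain (C : Finset (Finset ℕ)) : Prop where
  nonempty : C.Nonempty
  mem_nonempty : ∀ F ∈ C, F.Nonempty
  mem_schreier : ∀ F ∈ C, IsSchreier F
  consecutive : ∀ F ∈ C, ∀ G ∈ C, F ≠ G →
    (∀ m ∈ F, ∀ n ∈ G, m < n) ∨ (∀ m ∈ F, ∀ n ∈ G, n < m)

/-- `μ_p(x, F) = (∑_{n ∈ F} |x(n)|^p)^{1/p}`. -/
def mu {𝕜 : Type*} [RCLike 𝕜] (p : ℝ) (F : Finset ℕ) (x : ℕ → 𝕜) : ℝ :=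
  (∑ n ∈ F, ‖x n‖ ^ p) ^ (1 / p)

/-- `β_p(x, C) = (∑_{F ∈ C} (∑_{n ∈ F} |x(n)|)^p)^{1/p}`. -/
def beta {𝕜 : Type*} [RCLike 𝕜] (p : ℝ) (C : Finset (Finset ℕ)) (x : ℕ → 𝕜) : ℝ :=
  (∑ F ∈ C, (∑ n ∈ F, ‖x n‖) ^ p) ^ (1 / p)

section Seminorms

variable {𝕜 : Type*} [RCLike 𝕜] {p : ℝ}

theorem mu_add_le (hp : 1 ≤ p) (F : Finset ℕ) (x y : ℕ → 𝕜) :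
    mu p F (x + y) ≤ mu p F x + mu p F y := by
  have hp0 : 0 ≤ p := by linarith
  unfold mu
  refine le_trans ?_ (Real.Lp_add_le_of_nonneg F hp (f := fun n => ‖x n‖) (g := fun n => ‖y n‖)
    (fun _ _ => norm_nonneg _) (fun _ _ => norm_nonneg _))
  refine Real.rpow_le_rpow (Finset.sum_nonneg fun n _ => by positivity) ?_ (by positivity)
  exact Finset.sum_le_sum fun n _ =>
    Real.rpow_le_rpow (norm_nonneg _) (norm_add_le _ _) hp0

theorem mu_smul (hp : 1 ≤ p) (F : Finset ℕ) (a : 𝕜) (x : ℕ → 𝕜) :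
    mu p F (a • x) = ‖a‖ * mu p F x := by
  have hp0 : p ≠ 0 := by linarith
  unfold mu
  have h : ∑ n ∈ F, ‖(a • x) n‖ ^ p = ‖a‖ ^ p * ∑ n ∈ F, ‖x n‖ ^ p := by
    rw [Finset.mul_sum]
    refine Finset.sum_congr rfl fun n _ => ?_
    rw [Pi.smul_apply, norm_smul, Real.mul_rpow (norm_nonneg _) (norm_nonneg _)]
  rw [h, Real.mul_rpow (by positivity) (Finset.sum_nonneg fun n _ => by positivity), one_div,
    Real.rpow_rpow_inv (norm_nonneg _) hp0]

theorem beta_add_le (hp : 1 ≤ p) (C : Finset (Finset ℕ)) (x y : ℕ → 𝕜) :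
    beta p C (x + y) ≤ beta p C x + beta p C y := by
  have hp0 : 0 ≤ p := by linarith
  unfold beta
  refine le_trans ?_ (Real.Lp_add_le_of_nonneg C hp (f := fun F => ∑ n ∈ F, ‖x n‖)
    (g := fun F => ∑ n ∈ F, ‖y n‖) (fun _ _ => Finset.sum_nonneg fun _ _ => norm_nonneg _)
    (fun _ _ => Finset.sum_nonneg fun _ _ => norm_nonneg _))
  refine Real.rpow_le_rpow (Finset.sum_nonneg fun n _ => by positivity) ?_ (by positivity)
  refine Finset.sum_le_sum fun F _ => Real.rpow_le_rpow (by positivity) ?_ hp0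
  rw [← Finset.sum_add_distrib]
  exact Finset.sum_le_sum fun n _ => norm_add_le _ _

theorem beta_smul (hp : 1 ≤ p) (C : Finset (Finset ℕ)) (a : 𝕜) (x : ℕ → 𝕜) :
    beta p C (a • x) = ‖a‖ * beta p C x := by
  have hp0 : p ≠ 0 := by linarith
  unfold beta
  have h : ∑ F ∈ C, (∑ n ∈ F, ‖(a • x) n‖) ^ p
      = ‖a‖ ^ p * ∑ F ∈ C, (∑ n ∈ F, ‖x n‖) ^ p := by
    rw [Finset.mul_sum]
    refine Finset.sum_congr rfl fun F _ => ?_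
    rw [← Real.mul_rpow (norm_nonneg _) (Finset.sum_nonneg fun _ _ => norm_nonneg _),
      Finset.mul_sum]
    simp only [Pi.smul_apply, norm_smul]
  rw [h, Real.mul_rpow (by positivity) (Finset.sum_nonneg fun n _ => by positivity), one_div,
    Real.rpow_rpow_inv (norm_nonneg _) hp0]

theorem mu_singleton (hp : 1 ≤ p) (n : ℕ) (x : ℕ → 𝕜) : mu p {n} x = ‖x n‖ := by
  have hp0 : p ≠ 0 := by linarith
  simp [mu, Real.rpow_rpow_inv (norm_nonneg _) hp0]

theorem beta_singleton (hp : 1 ≤ p) (n : ℕ) (x : ℕ → 𝕜) : beta p {{n}} x = ‖x n‖ := by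
  have hp0 : p ≠ 0 := by linarith
  simp [beta, Real.rpow_rpow_inv (norm_nonneg _) hp0]

theorem isSchreier_singleton (n : ℕ) : IsSchreier {n} := by
  intro m _
  simp

theorem isSchreierChain_singleton (n : ℕ) : IsSchreierChain {{n}} where
  nonempty := by simp
  mem_nonempty := by simp
  mem_schreier := by simpa using isSchreier_singleton n
  consecutive := by
    intro F hF G hG h
    rw [Finset.mem_singleton] at hF hG
    exact absurd (hF.trans hG.symm) h

variable (𝕜 p) in
/-- The family of seminorms `μ_p(·, F)`, where `F` runs through the Schreier sets. -/
def muSeminorm [Fact (1 ≤ p)] (F : {F : Finset ℕ // IsSchreier F}) : Seminorm 𝕜 (ℕ → 𝕜) :=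
  Seminorm.of (mu p F.1) (mu_add_le Fact.out F.1) (mu_smul Fact.out F.1)

variable (𝕜 p) in
/-- The family of seminorms `β_p(·, C)`, where `C` runs through the Schreier chains. -/
def betaSeminorm [Fact (1 ≤ p)] (C : {C : Finset (Finset ℕ) // IsSchreierChain C}) :
    Seminorm 𝕜 (ℕ → 𝕜) :=
  Seminorm.of (beta p C.1) (beta_add_le Fact.out C.1) (beta_smul Fact.out C.1)

theorem muSeminorm_apply [Fact (1 ≤ p)] (F : {F : Finset ℕ // IsSchreier F}) (x : ℕ → 𝕜) :
    muSeminorm 𝕜 p F x = mu p F.1 x := rfl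

theorem betaSeminorm_apply [Fact (1 ≤ p)] (C : {C : Finset (Finset ℕ) // IsSchreierChain C})
    (x : ℕ → 𝕜) : betaSeminorm 𝕜 p C x = beta p C.1 x := rfl

end Seminorms

section SupNorm

variable {𝕜 : Type*} [RCLike 𝕜] {ι : Type*}

/-- The sequences `x` for which `sup_i q_i(x)` is finite. -/
def finiteSup (q : ι → Seminorm 𝕜 (ℕ → 𝕜)) : Submodule 𝕜 (ℕ → 𝕜) where
  carrier := {x | BddAbove (Set.range fun i => q i x)}
  zero_mem' := ⟨0, by rintro _ ⟨i, rfl⟩; simp⟩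
  add_mem' := by
    rintro x y ⟨a, ha⟩ ⟨b, hb⟩
    refine ⟨a + b, ?_⟩
    rintro _ ⟨i, rfl⟩
    exact (map_add_le_add (q i) x y).trans (add_le_add (ha ⟨i, rfl⟩) (hb ⟨i, rfl⟩))
  smul_mem' := by
    rintro c x ⟨a, ha⟩
    refine ⟨‖c‖ * a, ?_⟩
    rintro _ ⟨i, rfl⟩
    have h : q i (c • x) = ‖c‖ * q i x := map_smul_eq_mul (q i) c x
    exact h.le.trans (mul_le_mul_of_nonneg_left (ha ⟨i, rfl⟩) (norm_nonneg c))

theorem supNorm_zero_iff [Nonempty ι] (q : ι → Seminorm 𝕜 (ℕ → 𝕜))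
    (hq : ∀ x : ℕ → 𝕜, (∀ i, q i x = 0) → x = 0) (x : finiteSup q) :
    ⨆ i, q i x.1 = 0 ↔ x = 0 := by
  refine ⟨fun h => ?_, fun h => ?_⟩
  · refine Subtype.ext (hq _ fun i => le_antisymm ?_ (apply_nonneg _ _))
    rw [← h]
    exact le_ciSup x.2 i
  · subst h
    simp

theorem supNorm_smul (q : ι → Seminorm 𝕜 (ℕ → 𝕜)) (c : 𝕜) (x : finiteSup q) :
    ⨆ i, q i (c • x).1 = ‖c‖ * ⨆ i, q i x.1 := by
  rw [Real.mul_iSup_of_nonneg (norm_nonneg c)]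
  exact iSup_congr fun i => map_smul_eq_mul (q i) c x.1

theorem supNorm_add_le [Nonempty ι] (q : ι → Seminorm 𝕜 (ℕ → 𝕜)) (x y : finiteSup q) :
    ⨆ i, q i (x + y).1 ≤ (⨆ i, q i x.1) + ⨆ i, q i y.1 :=
  ciSup_le fun i => (map_add_le_add (q i) x.1 y.1).trans
    (add_le_add (le_ciSup x.2 i) (le_ciSup y.2 i))

end SupNorm

instance : Nonempty {F : Finset ℕ // IsSchreier F} := ⟨⟨{0}, isSchreier_singleton 0⟩⟩

instance : Nonempty {C : Finset (Finset ℕ) // IsSchreierChain C} :=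
  ⟨⟨{{0}}, isSchreierChain_singleton 0⟩⟩

section Spaces

variable (𝕜 : Type*) [RCLike 𝕜] (p : ℝ) [Fact (1 ≤ p)]

theorem muSeminorm_separates (x : ℕ → 𝕜) (hx : ∀ F, muSeminorm 𝕜 p F x = 0) : x = 0 := by
  funext n
  have h := hx ⟨{n}, isSchreier_singleton n⟩
  rw [muSeminorm_apply, mu_singleton Fact.out] at h
  exact norm_eq_zero.mp h

theorem betaSeminorm_separates (x : ℕ → 𝕜) (hx : ∀ C, betaSeminorm 𝕜 p C x = 0) : x = 0 := by
  funext n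
  have h := hx ⟨{{n}}, isSchreierChain_singleton n⟩
  rw [betaSeminorm_apply, beta_singleton Fact.out] at h
  exact norm_eq_zero.mp h

/-- The space `Z_p` of all sequences `x` with `sup {μ_p(x, F) : F a Schreier set} < ∞`. -/
def ZSpace : Type _ := finiteSup (muSeminorm 𝕜 p)

instance : AddCommGroup (ZSpace 𝕜 p) := inferInstanceAs (AddCommGroup (finiteSup _))

instance : Module 𝕜 (ZSpace 𝕜 p) := inferInstanceAs (Module 𝕜 (finiteSup _))

/-- `‖x‖_{S_p} = sup {μ_p(x, F) : F a Schreier set}`. -/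
instance : Norm (ZSpace 𝕜 p) := ⟨fun x => ⨆ F, muSeminorm 𝕜 p F x.1⟩

theorem zSpace_core : NormedSpace.Core 𝕜 (ZSpace 𝕜 p) where
  norm_nonneg x := Real.iSup_nonneg fun F => apply_nonneg (muSeminorm 𝕜 p F) x.1
  norm_smul c x := supNorm_smul (muSeminorm 𝕜 p) c x
  norm_triangle x y := supNorm_add_le (muSeminorm 𝕜 p) x y
  norm_eq_zero_iff x := supNorm_zero_iff (muSeminorm 𝕜 p) (muSeminorm_separates 𝕜 p) x

instance : NormedAddCommGroup (ZSpace 𝕜 p) := NormedAddCommGroup.ofCore (zSpace_core 𝕜 p)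

instance : NormedSpace 𝕜 (ZSpace 𝕜 p) := NormedSpace.ofCore (zSpace_core 𝕜 p)

theorem single_mem (n : ℕ) : (Pi.single n 1 : ℕ → 𝕜) ∈ finiteSup (muSeminorm 𝕜 p) := by
  have hp : 1 ≤ p := Fact.out
  have hp0 : p ≠ 0 := by linarith
  refine ⟨1, ?_⟩
  rintro _ ⟨F, rfl⟩
  change (∑ m ∈ F.1, ‖(Pi.single n 1 : ℕ → 𝕜) m‖ ^ p) ^ (1 / p) ≤ 1
  refine Real.rpow_le_one (Finset.sum_nonneg fun m _ => by positivity) ?_ (by positivity)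
  have h : ∀ m, ‖(Pi.single n 1 : ℕ → 𝕜) m‖ ^ p = if m = n then 1 else 0 := by
    intro m
    by_cases hm : m = n
    · subst hm; simp
    · simp [hm, Real.zero_rpow hp0]
  simp only [h, Finset.sum_ite_eq']
  split_ifs <;> norm_num

/-- The unit vector `e_n`, as an element of `Z_p`. -/
def unitVec (n : ℕ) : ZSpace 𝕜 p := ⟨Pi.single n 1, single_mem 𝕜 p n⟩

/-- The `p`-convexified Schreier space `S_p`: the closed linear span of the unit vector basis
in `Z_p`, with the norm of `Z_p`. -/
abbrev SchreierSpace : Type _ :=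
  (Submodule.span 𝕜 (Set.range (unitVec 𝕜 p))).topologicalClosure

/-- The Baernstein space `B_p` (considered only for `1 < p`): all sequences `x` with
`sup {β_p(x, C) : C a Schreier chain} < ∞`. -/
def BaernsteinSpace : Type _ := finiteSup (betaSeminorm 𝕜 p)

instance : AddCommGroup (BaernsteinSpace 𝕜 p) := inferInstanceAs (AddCommGroup (finiteSup _))

instance : Module 𝕜 (BaernsteinSpace 𝕜 p) := inferInstanceAs (Module 𝕜 (finiteSup _))

/-- `‖x‖_{B_p} = sup {β_p(x, C) : C a Schreier chain}`. -/
instance : Norm (BaernsteinSpace 𝕜 p) := ⟨fun x => ⨆ C, betaSeminorm 𝕜 p C x.1⟩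

theorem baernsteinSpace_core : NormedSpace.Core 𝕜 (BaernsteinSpace 𝕜 p) where
  norm_nonneg x := Real.iSup_nonneg fun C => apply_nonneg (betaSeminorm 𝕜 p C) x.1
  norm_smul c x := supNorm_smul (betaSeminorm 𝕜 p) c x
  norm_triangle x y := supNorm_add_le (betaSeminorm 𝕜 p) x y
  norm_eq_zero_iff x := supNorm_zero_iff (betaSeminorm 𝕜 p) (betaSeminorm_separates 𝕜 p) x

instance : NormedAddCommGroup (BaernsteinSpace 𝕜 p) :=
  NormedAddCommGroup.ofCore (baernsteinSpace_core 𝕜 p)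

instance : NormedSpace 𝕜 (BaernsteinSpace 𝕜 p) :=
  NormedSpace.ofCore (baernsteinSpace_core 𝕜 p)

end Spaces

section Operators

variable {𝕜 : Type*} [RCLike 𝕜] {E : Type*} [NormedAddCommGroup E] [NormedSpace 𝕜 E]

variable (𝕜 E) in
/-- The Banach algebra `𝓑(E)` of bounded operators on `E`. -/
abbrev Op : Type _ := E →L[𝕜] E

/-- `T` is strictly singular: it is not bounded below (that is, not an isomorphic embedding) on any
infinite-dimensional subspace. -/
def IsStrictlySingular (T : Op 𝕜 E) : Prop :=
  ∀ M : Submodule 𝕜 E, ¬ FiniteDimensional 𝕜 M → ¬ ∃ c : ℝ, 0 < c ∧ ∀ x ∈ M, c * ‖x‖ ≤ ‖T x‖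

/-- The proper filter `l` of subsets of `I` is a left approximate identity for `I`: `AT → T` in
operator norm as `A → l`, for each `T ∈ I`. (Proper filters on `I` play the role of nets in `I`.) -/
structure IsLeftApproxIdentity (I : Set (Op 𝕜 E)) (l : Filter (Op 𝕜 E)) : Prop where
  neBot : l.NeBot
  eventually_mem : ∀ᶠ A in l, A ∈ I
  tendsto : ∀ T ∈ I, Tendsto (fun A => A ∘L T) l (𝓝 T)

/-- Right approximate identities: `TA → T` in operator norm as `A → l`, for each `T ∈ I`. -/
structure IsRightApproxIdentity (I : Set (Op 𝕜 E)) (l : Filter (Op 𝕜 E)) : Prop where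
  neBot : l.NeBot
  eventually_mem : ∀ᶠ A in l, A ∈ I
  tendsto : ∀ T ∈ I, Tendsto (fun A => T ∘L A) l (𝓝 T)

variable (𝕜 E) in
/-- The set of compact operators on `E`. -/
def compactOps : Set (Op 𝕜 E) := {T | IsCompactOperator T}

/-- Small ideals of operators: those contained in the strictly singular operators. -/
def IsSmall (I : TwoSidedIdeal (Op 𝕜 E)) : Prop := ∀ T ∈ I, IsStrictlySingular T

end Operators

end SchreierBaernstein

end

open SchreierBaernstein

noncomputable section

namespace SchreierBaernstein

/-! Both spaces have a normalized 1-unconditional basis, and the theorem follows from three facts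
about block sequences `u`, `v` on common intervals, with `u` in the unit ball; they are collected in
`UnitBasis.IsSchreierLike`. If every `v n` has a coordinate of modulus at least 1, then `v`
dominates `u`. If `u` is flat (`N n` times each coordinate of `u n` is at most 1 in modulus, `N n`
being the left end of the interval), then every `v` with norms at least 1 dominates `u`: flat blocks
have an upper `c₀` estimate in `S_p` and an upper `ℓ_p` estimate in `B_p`, matching the lower
estimates valid for all blocks. Finally, some `k` makes the norm of every sum of `k` flat blocks
small compared with `k`.

The third fact makes bounded coordinatewise null sequences weakly null (`tendsto_functional`), since
long averages of blocks are flat. Operators therefore preserve coordinatewise nullity, and a gliding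
hump puts `u` and its image on common intervals. A strictly singular operator cannot let the image
dominate `u`. Hence it sends bounded coordinatewise null sequences to sup-norm null ones
(`supNull_apply`), and bounded sup-norm null ones to norm null ones (`tendsto_apply`). A product of
two such operators sends the former to norm null sequences, so it is the limit of its compositions
with the finite-rank basis projections, hence compact.

With an approximate identity in a small ideal, each member is a limit of such products, hence
compact. Conversely, a nonzero ideal contains the basis projections, and these form a contractive
two-sided approximate identity for the compact operators.

For the three facts, a Schreier set is cut after the first interval that it meets. The first piece
sees a single block. The cardinality of the rest is at most the left end of each interval it meets,
so one point per interval is again a Schreier set, and flat blocks have total mass at most 1 on it.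
-/

/-! ### Partitions of the index set into intervals -/

/-- The index `n` of the interval `[N n, N (n + 1))` that contains `j` (and `0` if `j < N 0`). -/
def blockIndex (N : ℕ → ℕ) (j : ℕ) : ℕ := Nat.findGreatest (fun n => N n ≤ j) j

section BlockIndex

variable {N : ℕ → ℕ}

/-- Strict monotonicity gives `n ≤ N n`, so the search bound `j` in `blockIndex` misses no
candidate. -/
theorem lt_blockIndex_succ (hN : StrictMono N) (j : ℕ) : j < N (blockIndex N j + 1) := by
  by_contra! h
  have h1 : blockIndex N j + 1 ≤ j := (hN.le_apply).trans h
  have := Nat.le_findGreatest (P := fun n => N n ≤ j) h1 h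
  exact absurd this (by simp [blockIndex])

theorem le_of_blockIndex_pos {j : ℕ} (h : 0 < blockIndex N j) : N (blockIndex N j) ≤ j :=
  Nat.findGreatest_of_ne_zero (P := fun n => N n ≤ j) rfl h.ne'

theorem blockIndex_eq (hN : StrictMono N) {n j : ℕ} (h : j ∈ Finset.Ico (N n) (N (n + 1))) :
    blockIndex N j = n := by
  rw [Finset.mem_Ico] at h
  refine le_antisymm ?_ (Nat.le_findGreatest (P := fun n => N n ≤ j) (hN.le_apply.trans h.1) h.1)
  by_contra! hlt
  have h1 : N (n + 1) ≤ N (blockIndex N j) := hN.monotone hlt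
  have h2 := le_of_blockIndex_pos (N := N) (j := j) (by omega)
  omega

theorem lt_of_blockIndex_lt (hN : StrictMono N) {i j : ℕ} (h : blockIndex N i < blockIndex N j) :
    i < N (blockIndex N j) ∧ N (blockIndex N j) ≤ j :=
  ⟨(lt_blockIndex_succ hN i).trans_le (hN.monotone h), le_of_blockIndex_pos (by omega)⟩

theorem blockIndex_mono (hN : StrictMono N) {i j : ℕ} (h : i ≤ j) :
    blockIndex N i ≤ blockIndex N j := by
  by_contra! hlt
  have := lt_of_blockIndex_lt hN hlt
  omega

end BlockIndex

/-- A recursive choice of indices `φ n` and interlaced end points `N n`. -/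
theorem exists_interlaced (R : ℕ → ℕ → ℕ → ℕ → Prop)
    (h : ∀ n N, ∀ᶠ m in atTop, ∀ᶠ N' in atTop, R n N m N') :
    ∃ φ N : ℕ → ℕ, StrictMono N ∧ ∀ n, R n (N n) (φ n) (N (n + 1)) := by
  have h' : ∀ n N, ∃ m N', N < N' ∧ R n N m N' := fun n N => by
    obtain ⟨m, hm⟩ := (h n N).exists
    obtain ⟨N', h1, h2⟩ := (hm.and (eventually_gt_atTop N)).exists
    exact ⟨m, N', h2, h1⟩
  choose m N' hlt hR using h'
  let N : ℕ → ℕ := fun n => Nat.rec 0 (fun k r => N' k r) n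
  exact ⟨fun n => m n (N n), N, strictMono_nat_of_lt_succ fun n => hlt n (N n),
    fun n => hR n (N n)⟩

/-! ### Unconditional unit vector bases -/

/-- A normalized `1`-unconditional basis: coordinate functionals and unit vectors, such that the
norm is monotone in the absolute values of the coordinates and the basis expansions converge. -/
structure UnitBasis (𝕜 E : Type*) [RCLike 𝕜] [NormedAddCommGroup E] [NormedSpace 𝕜 E] where
  /-- The coordinate functionals. -/
  coord : ℕ → E →L[𝕜] 𝕜
  /-- The basis vectors. -/
  vec : ℕ → E
  coord_vec : ∀ m n, coord m (vec n) = if m = n then 1 else 0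
  norm_coord_le : ∀ n x, ‖coord n x‖ ≤ ‖x‖
  norm_le_norm : ∀ x y, (∀ n, ‖coord n x‖ ≤ ‖coord n y‖) → ‖x‖ ≤ ‖y‖
  tendsto_sum : ∀ x, Tendsto (fun N => ∑ i ∈ Finset.range N, coord i x • vec i) atTop (𝓝 x)

namespace UnitBasis

variable {𝕜 E : Type*} [RCLike 𝕜] [NormedAddCommGroup E] [NormedSpace 𝕜 E] (B : UnitBasis 𝕜 E)

/-- The basis projection onto the coordinates in `s`. -/
def proj (s : Finset ℕ) : E →L[𝕜] E := ∑ i ∈ s, (B.coord i).smulRight (B.vec i)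

theorem proj_apply (s : Finset ℕ) (x : E) : B.proj s x = ∑ i ∈ s, B.coord i x • B.vec i := by
  simp [proj]

theorem coord_proj (s : Finset ℕ) (x : E) (j : ℕ) :
    B.coord j (B.proj s x) = if j ∈ s then B.coord j x else 0 := by
  simp [proj_apply, B.coord_vec]

theorem norm_proj_apply_le (s : Finset ℕ) (x : E) : ‖B.proj s x‖ ≤ ‖x‖ :=
  B.norm_le_norm _ _ fun n => by
    rw [coord_proj]
    split_ifs <;> simp

theorem norm_proj_le (s : Finset ℕ) : ‖B.proj s‖ ≤ 1 :=
  ContinuousLinearMap.opNorm_le_bound _ zero_le_one fun x => by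
    simpa using B.norm_proj_apply_le s x

theorem norm_sub_proj_apply_le (s : Finset ℕ) (x : E) : ‖x - B.proj s x‖ ≤ ‖x‖ :=
  B.norm_le_norm _ _ fun n => by
    rw [map_sub, coord_proj]
    split_ifs <;> simp

theorem tendsto_proj (x : E) :
    Tendsto (fun N => B.proj (Finset.range N) x) atTop (𝓝 x) := by
  simpa only [proj_apply] using B.tendsto_sum x

theorem eq_zero_of_coord {x : E} (h : ∀ n, B.coord n x = 0) : x = 0 := by
  simpa using B.norm_le_norm x 0 (by simp [h])

theorem isCompactOperator_proj (s : Finset ℕ) : IsCompactOperator (B.proj s) := by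
  classical
  induction s using Finset.induction_on with
  | empty => simpa [proj] using isCompactOperator_zero
  | insert i s hi ih =>
    have h : B.proj (insert i s) = (B.coord i).smulRight (B.vec i) + B.proj s := by
      simp [proj, Finset.sum_insert hi]
    rw [h]
    refine IsCompactOperator.add ?_ ih
    have h1 : IsCompactOperator (B.coord i) := isCompactOperator_of_locallyCompactSpace_dom _
    exact h1.clm_comp ((1 : 𝕜 →L[𝕜] 𝕜).smulRight (B.vec i))

/-! ### Null sequences and block sequences -/

/-- Coordinatewise null sequences. -/
def CoordNull (u : ℕ → E) : Prop := ∀ j, Tendsto (fun n => B.coord j (u n)) atTop (𝓝 0)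

/-- Sequences whose coordinates tend to `0` uniformly. -/
def SupNull (u : ℕ → E) : Prop := ∀ ε > 0, ∀ᶠ n in atTop, ∀ j, ‖B.coord j (u n)‖ ≤ ε

theorem CoordNull.comp {B : UnitBasis 𝕜 E} {u : ℕ → E} (hu : B.CoordNull u) {φ : ℕ → ℕ}
    (hφ : StrictMono φ) : B.CoordNull (u ∘ φ) :=
  fun j => (hu j).comp hφ.tendsto_atTop

theorem SupNull.comp {B : UnitBasis 𝕜 E} {u : ℕ → E} (hu : B.SupNull u) {φ : ℕ → ℕ}
    (hφ : StrictMono φ) : B.SupNull (u ∘ φ) :=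
  fun ε hε => hφ.tendsto_atTop.eventually (hu ε hε)

theorem SupNull.coordNull {B : UnitBasis 𝕜 E} {u : ℕ → E} (hu : B.SupNull u) :
    B.CoordNull u := fun j => by
  rw [NormedAddGroup.tendsto_nhds_zero]
  intro ε hε
  filter_upwards [hu (ε / 2) (by positivity)] with n hn
  linarith [hn j]

/-- One step of the gliding hump: the finitely many coordinates before `N` die as `m` grows, and for
fixed `m` the basis expansion lets `N'` cut off the tail. -/
theorem CoordNull.eventually_norm_sub_proj_le {B : UnitBasis 𝕜 E} {u : ℕ → E}
    (hu : B.CoordNull u) (N : ℕ) {ε : ℝ} (hε : 0 < ε) :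
    ∀ᶠ m in atTop, ∀ᶠ N' in atTop, ‖u m - B.proj (Finset.Ico N N') (u m)‖ ≤ ε := by
  have h1 : Tendsto (fun m => ‖B.proj (Finset.range N) (u m)‖) atTop (𝓝 0) := by
    rw [tendsto_zero_iff_norm_tendsto_zero.symm]
    simp only [proj_apply]
    rw [← Finset.sum_const_zero (s := Finset.range N) (ι := ℕ)]
    refine tendsto_finsetSum _ fun i _ => ?_
    simpa using (hu i).smul_const (B.vec i)
  filter_upwards [h1.eventually_lt_const (half_pos hε)] with m hm
  have h2 : Tendsto (fun N' => ‖u m - B.proj (Finset.range N') (u m)‖) atTop (𝓝 0) := by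
    simpa using (tendsto_const_nhds (x := u m)).sub (B.tendsto_proj (u m)) |>.norm
  filter_upwards [h2.eventually_lt_const (half_pos hε), eventually_ge_atTop N] with N' hN' hle
  have h3 : B.proj (Finset.Ico N N') (u m)
      = B.proj (Finset.range N') (u m) - B.proj (Finset.range N) (u m) := by
    simp only [proj_apply]
    rw [Finset.sum_Ico_eq_sub _ hle]
  rw [h3]
  calc _ = ‖(u m - B.proj (Finset.range N') (u m)) + B.proj (Finset.range N) (u m)‖ := by
        congr 1; abel
    _ ≤ _ := norm_add_le _ _
    _ ≤ ε := by linarith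

/-- `u n` is supported on the interval `[N n, N (n + 1))`. -/
def IsBlock (N : ℕ → ℕ) (u : ℕ → E) : Prop :=
  ∀ n j, j ∉ Finset.Ico (N n) (N (n + 1)) → B.coord j (u n) = 0

theorem isBlock_proj (N : ℕ → ℕ) (u : ℕ → E) :
    B.IsBlock N fun n => B.proj (Finset.Ico (N n) (N (n + 1))) (u n) := fun n j hj => by
  simp [coord_proj, hj]

theorem IsBlock.smul {B : UnitBasis 𝕜 E} {N : ℕ → ℕ} {u : ℕ → E} (hu : B.IsBlock N u)
    (c : ℕ → 𝕜) : B.IsBlock N fun n => c n • u n := fun n j hj => by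
  simp [hu n j hj]

/-- Only one block can be nonzero at `j`. The default index `0` for `j < N 0` does no harm, because
`u 0` vanishes there. -/
theorem IsBlock.coord_sum {B : UnitBasis 𝕜 E} {N : ℕ → ℕ} {u : ℕ → E} (hN : StrictMono N)
    (hu : B.IsBlock N u) (s : Finset ℕ) (a : ℕ → 𝕜) (j : ℕ) :
    B.coord j (∑ n ∈ s, a n • u n) = if blockIndex N j ∈ s then
      a (blockIndex N j) * B.coord j (u (blockIndex N j)) else 0 := by
  simp only [map_sum, map_smul, smul_eq_mul]
  have h : ∀ n, n ≠ blockIndex N j → a n * B.coord j (u n) = 0 := fun n hn => by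
    rw [hu n j fun hj => hn (blockIndex_eq hN hj).symm, mul_zero]
  split_ifs with hs
  · exact Finset.sum_eq_single _ (fun n _ hn => h n hn) fun h => absurd hs h
  · exact Finset.sum_eq_zero fun n hn => h n fun h => hs (h ▸ hn)

theorem IsBlock.norm_mul_le {B : UnitBasis 𝕜 E} {N : ℕ → ℕ} {u : ℕ → E} (hN : StrictMono N)
    (hu : B.IsBlock N u) (s : Finset ℕ) (a : ℕ → 𝕜) {n : ℕ} (hn : n ∈ s) :
    ‖a n‖ * ‖u n‖ ≤ ‖∑ n ∈ s, a n • u n‖ := by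
  rw [← norm_smul]
  refine B.norm_le_norm _ _ fun j => ?_
  rw [hu.coord_sum hN, map_smul, smul_eq_mul]
  by_cases hj : j ∈ Finset.Ico (N n) (N (n + 1))
  · rw [blockIndex_eq hN hj, if_pos hn]
  · rw [hu n j hj]
    simp

/-- The estimates for block sequences that the Schreier and Baernstein spaces share. -/
structure IsSchreierLike : Prop where
  -- The constant 4 is what the Baernstein norm needs; the Schreier norm gives 2.
  norm_sum_le_of_coord : ∀ (N : ℕ → ℕ) (u v : ℕ → E), StrictMono N → B.IsBlock N u →
    B.IsBlock N v → (∀ n, ‖u n‖ ≤ 1) → (∀ n, ∃ j, 1 ≤ ‖B.coord j (v n)‖) →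
    ∀ (s : Finset ℕ) (a : ℕ → 𝕜), ‖∑ n ∈ s, a n • u n‖ ≤ 4 * ‖∑ n ∈ s, a n • v n‖
  norm_sum_le_of_small : ∀ (N : ℕ → ℕ) (u v : ℕ → E), StrictMono N → B.IsBlock N u →
    B.IsBlock N v → (∀ n, ‖u n‖ ≤ 1) → (∀ n j, N n * ‖B.coord j (u n)‖ ≤ 1) →
    (∀ n, 1 ≤ ‖v n‖) →
    ∀ (s : Finset ℕ) (a : ℕ → 𝕜), ‖∑ n ∈ s, a n • u n‖ ≤ 4 * ‖∑ n ∈ s, a n • v n‖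
  exists_norm_sum_le : ∀ η > 0, ∃ k : ℕ, 0 < k ∧ ∀ (N : ℕ → ℕ) (u : ℕ → E), StrictMono N →
    B.IsBlock N u → (∀ n, ‖u n‖ ≤ 1) → (∀ n j, N n * ‖B.coord j (u n)‖ ≤ 1) →
    ‖∑ n ∈ Finset.range k, u n‖ ≤ η * k

end UnitBasis

/-! ### Operators bounded below on the span of a sequence -/

section

variable {𝕜 E : Type*} [RCLike 𝕜] [NormedAddCommGroup E] [NormedSpace 𝕜 E]

theorem not_isStrictlySingular_of_le (S : Op 𝕜 E) (u : ℕ → E) {K : ℝ}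
    (hS : ∀ (s : Finset ℕ) (a : ℕ → 𝕜),
      ‖∑ n ∈ s, a n • u n‖ ≤ K * ‖∑ n ∈ s, a n • S (u n)‖)
    (hu : LinearIndependent 𝕜 u) : ¬ IsStrictlySingular S := by
  intro h
  refine h (Submodule.span 𝕜 (Set.range u)) (fun hfin => ?_)
    ⟨(|K| + 1)⁻¹, by positivity, fun x hx => ?_⟩
  · have := (linearIndependent_span hu).finite
    exact not_finite ℕ
  · rw [Finsupp.mem_span_range_iff_exists_finsupp] at hx
    obtain ⟨c, rfl⟩ := hx
    have h1 := hS c.support c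
    rw [inv_mul_le_iff₀ (by positivity), Finsupp.sum, map_sum]
    simp only [map_smul]
    refine h1.trans (mul_le_mul_of_nonneg_right ?_ (norm_nonneg _))
    linarith [le_abs_self K]

theorem norm_sum_smul_sub_le (x y : ℕ → E) (s : Finset ℕ) (a : ℕ → 𝕜) {δ A : ℝ}
    (hA : 0 ≤ A) (hxy : ∀ n, ‖x n - y n‖ ≤ δ / 2 * (1 / 2) ^ (n + 1))
    (ha : ∀ n ∈ s, δ * ‖a n‖ ≤ A) :
    ‖∑ n ∈ s, a n • x n - ∑ n ∈ s, a n • y n‖ ≤ A / 2 := by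
  rw [← Finset.sum_sub_distrib]
  calc _ ≤ ∑ n ∈ s, ‖a n • x n - a n • y n‖ := norm_sum_le _ _
    _ ≤ ∑ n ∈ s, A / 2 * (1 / 2) ^ (n + 1) := by
      refine Finset.sum_le_sum fun n hn => ?_
      rw [← smul_sub, norm_smul]
      calc _ ≤ ‖a n‖ * (δ / 2 * (1 / 2) ^ (n + 1)) := by gcongr; exact hxy n
        _ = (δ * ‖a n‖) / 2 * (1 / 2) ^ (n + 1) := by ring
        _ ≤ _ := by gcongr; exact ha n hn
    _ = A / 4 * ∑ n ∈ s, (1 / 2) ^ n := by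
      rw [Finset.mul_sum]
      exact Finset.sum_congr rfl fun n _ => by ring
    _ ≤ A / 4 * 2 := by
      gcongr
      exact (summable_geometric_two.sum_le_tsum s fun _ _ => by positivity).trans_eq
        tsum_geometric_two
    _ = _ := by ring

/-- By `hlow` the coefficients are controlled by the norm of the `v'`-sum, so the geometrically
small errors add up to at most half of that norm. The estimate for `u'` and `v'` thus passes to `u`
and its image with constant `2 * K + 1`, and `hlow` also yields linear independence. -/
theorem not_isStrictlySingular_of_perturbation (S : Op 𝕜 E) (u u' v' : ℕ → E) {δ K : ℝ}
    (hδ : 0 < δ) (hK : 0 ≤ K)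
    (hu : ∀ n, ‖u n - u' n‖ ≤ δ / 2 * (1 / 2) ^ (n + 1))
    (hv : ∀ n, ‖S (u n) - v' n‖ ≤ δ / 2 * (1 / 2) ^ (n + 1))
    (hdom : ∀ (s : Finset ℕ) (a : ℕ → 𝕜), ‖∑ n ∈ s, a n • u' n‖ ≤ K * ‖∑ n ∈ s, a n • v' n‖)
    (hlow : ∀ (s : Finset ℕ) (a : ℕ → 𝕜), ∀ n ∈ s, δ * ‖a n‖ ≤ ‖∑ n ∈ s, a n • v' n‖) :
    ¬ IsStrictlySingular S := by
  have h1 : ∀ (s : Finset ℕ) (a : ℕ → 𝕜),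
      ‖∑ n ∈ s, a n • v' n‖ ≤ 2 * ‖∑ n ∈ s, a n • S (u n)‖ := fun s a => by
    have h := norm_sum_smul_sub_le _ _ s a (norm_nonneg _) hv (hlow s a)
    have := norm_sub_norm_le (∑ n ∈ s, a n • v' n) (∑ n ∈ s, a n • S (u n))
    rw [norm_sub_rev] at h
    linarith
  refine not_isStrictlySingular_of_le S u (K := 2 * K + 1) (fun s a => ?_) ?_
  · have h := norm_sum_smul_sub_le _ _ s a (norm_nonneg _) hu (hlow s a)
    have h2 := norm_sub_norm_le (∑ n ∈ s, a n • u n) (∑ n ∈ s, a n • u' n)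
    have h3 := hdom s a
    have h4 := mul_le_mul_of_nonneg_left (h1 s a) hK
    linarith [h1 s a]
  · rw [linearIndependent_iff']
    intro s a hs n hn
    have h2 : ∑ n ∈ s, a n • S (u n) = 0 := by
      simpa using congrArg S hs
    have h3 := h1 s a
    rw [h2, norm_zero, mul_zero] at h3
    have h4 := (hlow s a n hn).trans h3
    have h5 : ‖a n‖ ≤ 0 := nonpos_of_mul_nonpos_right h4 hδ
    simpa using h5

end

namespace UnitBasis

variable {𝕜 E : Type*} [RCLike 𝕜] [NormedAddCommGroup E] [NormedSpace 𝕜 E] {B : UnitBasis 𝕜 E}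

/-! ### Bounded coordinatewise null sequences are weakly null -/

/-- Averaging over enough consecutive blocks flattens them, while a functional that is constant on
the blocks keeps its value. -/
theorem IsBlock.exists_average {N : ℕ → ℕ} (hN : StrictMono N) {z : ℕ → E} (hz : B.IsBlock N z)
    (hz1 : ∀ n, ‖z n‖ ≤ 1) (f : E →L[𝕜] 𝕜) {d : 𝕜} (hf : ∀ n, f (z n) = d) :
    ∃ (N' : ℕ → ℕ) (y : ℕ → E), StrictMono N' ∧ B.IsBlock N' y ∧ (∀ n, ‖y n‖ ≤ 1) ∧
      (∀ n j, N' n * ‖B.coord j (y n)‖ ≤ 1) ∧ ∀ n, f (y n) = d := by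
  -- The `i`-th average has at least `N (M i)` terms, as many as the left end of its new interval;
  -- the chosen indices are irrelevant here.
  obtain ⟨-, M, hM, hMN⟩ := exists_interlaced (fun _ m _ m' => N m + m ≤ m')
    fun n m => Eventually.of_forall fun _ => eventually_ge_atTop _
  let c : ℕ → ℕ := fun i => M (i + 1) - M i
  have hlt : ∀ i, M i < M (i + 1) := fun i => hM (Nat.lt_succ_self i)
  have hc : ∀ i, 0 < (c i : ℝ) := fun i => by
    have := hlt i
    simp only [c, Nat.cast_pos]
    omega
  have hcard : ∀ i, (Finset.Ico (M i) (M (i + 1))).card = c i := fun i => by simp [c]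
  let y : ℕ → E := fun i => ∑ n ∈ Finset.Ico (M i) (M (i + 1)), ((c i : 𝕜)⁻¹) • z n
  have hcoord : ∀ i j, B.coord j (y i) =
      if blockIndex N j ∈ Finset.Ico (M i) (M (i + 1)) then
        (c i : 𝕜)⁻¹ * B.coord j (z (blockIndex N j)) else 0 := fun i j =>
    hz.coord_sum hN _ (fun _ => (c i : 𝕜)⁻¹) j
  refine ⟨N ∘ M, y, hN.comp hM, fun i j hj => ?_, fun i => ?_, fun i j => ?_, fun i => ?_⟩
  · rw [hcoord]
    split_ifs with h
    · rw [hz, mul_zero]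
      rw [Finset.mem_Ico] at h
      intro hmem
      rw [Finset.mem_Ico] at hmem
      refine hj (Finset.mem_Ico.2 ⟨(hN.monotone h.1).trans hmem.1, hmem.2.trans_le ?_⟩)
      exact hN.monotone h.2
    · rfl
  · calc ‖y i‖ ≤ ∑ n ∈ Finset.Ico (M i) (M (i + 1)), ‖((c i : 𝕜)⁻¹) • z n‖ := norm_sum_le _ _
      _ ≤ ∑ n ∈ Finset.Ico (M i) (M (i + 1)), (c i : ℝ)⁻¹ := by
        refine Finset.sum_le_sum fun n _ => ?_
        rw [norm_smul, norm_inv, RCLike.norm_natCast]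
        exact mul_le_of_le_one_right (inv_nonneg.2 (hc i).le) (hz1 n)
      _ = 1 := by
        rw [Finset.sum_const, hcard, nsmul_eq_mul, mul_inv_cancel₀ (hc i).ne']
  · have h1 : ‖B.coord j (y i)‖ ≤ (c i : ℝ)⁻¹ := by
      rw [hcoord]
      split_ifs
      · rw [norm_mul, norm_inv, RCLike.norm_natCast]
        exact mul_le_of_le_one_right (inv_nonneg.2 (hc i).le)
          ((B.norm_coord_le _ _).trans (hz1 _))
      · simp
    have h2 : ((N ∘ M) i : ℝ) ≤ c i := by
      have := hMN i
      simp only [c, Function.comp_apply, Nat.cast_le]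
      omega
    calc _ ≤ (c i : ℝ) * (c i : ℝ)⁻¹ := by gcongr
      _ = 1 := mul_inv_cancel₀ (hc i).ne'
  · have h : (c i : 𝕜) ≠ 0 := by exact_mod_cast (hc i).ne'
    simp only [y, map_sum, map_smul, hf, smul_eq_mul, Finset.sum_const, hcard, nsmul_eq_mul]
    rw [← mul_assoc, mul_inv_cancel₀ h, one_mul]

/-- Otherwise a functional takes one nonzero value on a sequence of flat blocks, so it grows
linearly on their sums, whose norms do not. -/
theorem IsSchreierLike.tendsto_functional (hB : B.IsSchreierLike) (f : E →L[𝕜] 𝕜) {u : ℕ → E}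
    (hu1 : ∀ n, ‖u n‖ ≤ 1) (hu : B.CoordNull u) : Tendsto (fun n => f (u n)) atTop (𝓝 0) := by
  by_contra hcon
  rw [NormedAddGroup.tendsto_nhds_zero] at hcon
  push Not at hcon
  obtain ⟨δ, hδ, hfr⟩ := hcon
  obtain ⟨φ, hφ, hφu⟩ := extraction_of_frequently_atTop hfr
  have hε : 0 < δ / (2 * (‖f‖ + 1)) := by positivity
  obtain ⟨m, N, hN, hR⟩ := exists_interlaced
    (fun _ N m N' => ‖(u ∘ φ) m - B.proj (Finset.Ico N N') ((u ∘ φ) m)‖ ≤ δ / (2 * (‖f‖ + 1)))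
    fun n N => (hu.comp hφ).eventually_norm_sub_proj_le N hε
  let x : ℕ → E := fun n => B.proj (Finset.Ico (N n) (N (n + 1))) ((u ∘ φ) (m n))
  have hx1 : ∀ n, ‖x n‖ ≤ 1 := fun n => (B.norm_proj_apply_le _ _).trans (hu1 _)
  have hfx : ∀ n, δ / 2 ≤ ‖f (x n)‖ := fun n => by
    have h1 : ‖f ((u ∘ φ) (m n) - x n)‖ ≤ δ / 2 := by
      refine (f.le_opNorm _).trans ?_
      calc _ ≤ (‖f‖ + 1) * (δ / (2 * (‖f‖ + 1))) :=
            mul_le_mul (by linarith) (hR n) (norm_nonneg _) (by positivity)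
        _ = δ / 2 := by field_simp
    rw [map_sub] at h1
    have h2 := norm_sub_norm_le (f ((u ∘ φ) (m n))) (f (x n))
    have h3 : δ ≤ ‖f ((u ∘ φ) (m n))‖ := hφu (m n)
    linarith
  have hfx0 : ∀ n, f (x n) ≠ 0 := fun n h => by
    have := hfx n
    rw [h, norm_zero] at this
    linarith
  -- Rescaling makes all values of `f` equal to `δ / 2`, so that no cancellation occurs in averages;
  -- the factors have modulus at most 1.
  have hz : B.IsBlock N fun n => (((δ / 2 : ℝ) : 𝕜) / f (x n)) • x n :=
    (B.isBlock_proj N _).smul _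
  obtain ⟨N', y, hN', hy, hy1, hysmall, hfy⟩ := hz.exists_average hN (fun n => by
    rw [norm_smul, norm_div, RCLike.norm_ofReal, abs_of_pos (by positivity)]
    refine mul_le_one₀ (div_le_one_of_le₀ (hfx n) (norm_nonneg _)) (norm_nonneg _) (hx1 n)) f
    (d := ((δ / 2 : ℝ) : 𝕜)) fun n => by
      rw [map_smul, smul_eq_mul, div_mul_cancel₀ _ (hfx0 n)]
  -- This choice bounds the value on the sum by `k * (δ / 4)`, half of its true size.
  obtain ⟨k, hk, hsum⟩ := hB.exists_norm_sum_le (δ / (4 * (‖f‖ + 1))) (by positivity)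
  have h1 := hsum N' y hN' hy hy1 hysmall
  have h2 : ‖f (∑ n ∈ Finset.range k, y n)‖ = k * (δ / 2) := by
    rw [map_sum]
    simp only [hfy, Finset.sum_const, Finset.card_range, nsmul_eq_mul, norm_mul,
      RCLike.norm_natCast, RCLike.norm_ofReal]
    rw [abs_of_pos (by positivity)]
  have h3 : ‖f (∑ n ∈ Finset.range k, y n)‖ ≤ k * (δ / 4) := by
    refine (f.le_opNorm _).trans ?_
    calc _ ≤ (‖f‖ + 1) * (δ / (4 * (‖f‖ + 1)) * k) :=
          mul_le_mul (by linarith) h1 (norm_nonneg _) (by positivity)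
      _ = k * (δ / 4) := by field_simp
  have hk' : (0 : ℝ) < k := by exact_mod_cast hk
  nlinarith

theorem IsSchreierLike.coordNull_apply (hB : B.IsSchreierLike) (T : Op 𝕜 E) {u : ℕ → E}
    (hu1 : ∀ n, ‖u n‖ ≤ 1) (hu : B.CoordNull u) : B.CoordNull fun n => T (u n) :=
  fun j => hB.tendsto_functional (B.coord j ∘L T) hu1 hu

/-! ### Strictly singular operators on coordinatewise null sequences -/

/-- The common core of `supNull_apply` and `tendsto_apply`: on a subsequence the images dominate the
original vectors, through the first or the second block estimate according to the alternative in
`h`. -/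
theorem IsSchreierLike.not_isStrictlySingular (hB : B.IsSchreierLike) (S : Op 𝕜 E) {u : ℕ → E}
    {δ : ℝ} (hδ : 0 < δ) (hu1 : ∀ n, ‖u n‖ ≤ 1) (hu : B.CoordNull u)
    (hSu : ∀ n, δ ≤ ‖S (u n)‖)
    (h : (∀ n, ∃ j, δ ≤ ‖B.coord j (S (u n))‖) ∨ B.SupNull u) :
    ¬ IsStrictlySingular S := by
  have hε : ∀ n : ℕ, 0 < (δ / 2) / 2 * (1 / 2) ^ (n + 1) := fun n => by positivity
  have hε' : ∀ n : ℕ, (δ / 2) / 2 * (1 / 2) ^ (n + 1) ≤ δ / 2 := fun n => by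
    have : ((1 : ℝ) / 2) ^ (n + 1) ≤ 1 := pow_le_one₀ (by norm_num) (by norm_num)
    nlinarith
  have hv := hB.coordNull_apply S hu1 hu
  -- One choice of intervals captures both `u` and its image. As `N` is fixed before `m`, sup-norm
  -- nullity can make the next block flat relative to its left end.
  obtain ⟨m, N, hN, hR⟩ := exists_interlaced
    (fun n N m N' => ‖u m - B.proj (Finset.Ico N N') (u m)‖ ≤ (δ / 2) / 2 * (1 / 2) ^ (n + 1) ∧
      ‖S (u m) - B.proj (Finset.Ico N N') (S (u m))‖ ≤ (δ / 2) / 2 * (1 / 2) ^ (n + 1) ∧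
      (B.SupNull u → ∀ j, N * ‖B.coord j (u m)‖ ≤ 1)) fun n N => by
    have h3 : ∀ᶠ m in atTop, B.SupNull u → ∀ j, N * ‖B.coord j (u m)‖ ≤ 1 := by
      by_cases hs : B.SupNull u
      · filter_upwards [hs (1 / (N + 1)) (by positivity)] with m hm _ j
        calc _ ≤ ((N : ℝ) + 1) * (1 / (N + 1)) :=
              mul_le_mul (by linarith) (hm j) (norm_nonneg _) (by positivity)
          _ = 1 := by field_simp
      · exact Eventually.of_forall fun m h => absurd h hs
    filter_upwards [hu.eventually_norm_sub_proj_le N (hε n),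
      hv.eventually_norm_sub_proj_le N (hε n), h3] with m h1 h2 h3
    filter_upwards [h1, h2] with N' h1 h2
    exact ⟨h1, h2, h3⟩
  set u' : ℕ → E := fun n => B.proj (Finset.Ico (N n) (N (n + 1))) (u (m n)) with hu'
  set v' : ℕ → E := fun n => B.proj (Finset.Ico (N n) (N (n + 1))) (S (u (m n))) with hv'
  have hbu : B.IsBlock N u' := B.isBlock_proj N _
  have hbv : B.IsBlock N v' := B.isBlock_proj N _
  have hu'1 : ∀ n, ‖u' n‖ ≤ 1 := fun n => (B.norm_proj_apply_le _ _).trans (hu1 _)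
  have hvn : ∀ n, δ / 2 ≤ ‖v' n‖ := fun n => by
    have h1 := norm_sub_norm_le (S (u (m n))) (v' n)
    have h2 := (hR n).2.1.trans (hε' n)
    linarith [hSu (m n)]
  -- Truncation costs at most `δ / 2`, so scaling by `2 / δ` brings the norms or peaks of `v'` up to
  -- at least 1.
  have hdom : ∀ (s : Finset ℕ) (a : ℕ → 𝕜), ‖∑ n ∈ s, a n • u' n‖ ≤
      4 * ‖∑ n ∈ s, a n • ((2 / δ : ℝ) : 𝕜) • v' n‖ := by
    have hnorm : ‖((2 / δ : ℝ) : 𝕜)‖ = 2 / δ := by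
      rw [RCLike.norm_ofReal, abs_of_pos (by positivity)]
    have hone : ∀ r : ℝ, δ / 2 ≤ r → 1 ≤ 2 / δ * r := fun r hr => by
      calc 1 = 2 / δ * (δ / 2) := by field_simp
        _ ≤ _ := by gcongr
    rcases h with h | h
    · refine hB.norm_sum_le_of_coord N u' _ hN hbu (hbv.smul _) hu'1 fun n => ?_
      obtain ⟨j, hj⟩ := h (m n)
      refine ⟨j, ?_⟩
      rw [map_smul, smul_eq_mul, norm_mul, hnorm]
      refine hone _ ?_
      have h1 := B.norm_coord_le j (S (u (m n)) - v' n)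
      have h2 := (hR n).2.1.trans (hε' n)
      rw [map_sub] at h1
      have h3 := norm_sub_norm_le (B.coord j (S (u (m n)))) (B.coord j (v' n))
      have h4 : ‖S (u (m n)) - v' n‖ ≤ δ / 2 := h2
      linarith
    · refine hB.norm_sum_le_of_small N u' _ hN hbu (hbv.smul _) hu'1 (fun n j => ?_) fun n => ?_
      · refine le_trans ?_ ((hR n).2.2 h j)
        gcongr
        rw [hu', coord_proj]
        split_ifs <;> simp
      · rw [norm_smul, hnorm]
        exact hone _ (hvn n)
  refine not_isStrictlySingular_of_perturbation S (u ∘ m) u' v' (half_pos hδ)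
    (K := 4 * (2 / δ)) (by positivity) (fun n => (hR n).1) (fun n => (hR n).2.1)
    (fun s a => ?_) fun s a n hn => ?_
  · refine (hdom s a).trans_eq ?_
    simp only [smul_comm (a _) (((2 / δ : ℝ) : 𝕜))]
    rw [← Finset.smul_sum, norm_smul, RCLike.norm_ofReal, abs_of_pos (by positivity), mul_assoc]
  · refine le_trans ?_ (hbv.norm_mul_le hN s a hn)
    rw [mul_comm]
    exact mul_le_mul_of_nonneg_left (hvn n) (norm_nonneg _)

theorem IsSchreierLike.supNull_apply (hB : B.IsSchreierLike) {S : Op 𝕜 E}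
    (hS : IsStrictlySingular S) {u : ℕ → E} (hu1 : ∀ n, ‖u n‖ ≤ 1) (hu : B.CoordNull u) :
    B.SupNull fun n => S (u n) := by
  intro ε hε
  by_contra hcon
  rw [not_eventually] at hcon
  push Not at hcon
  obtain ⟨φ, hφ, h⟩ := extraction_of_frequently_atTop hcon
  have h' : ∀ n, ∃ j, ε ≤ ‖B.coord j (S ((u ∘ φ) n))‖ := fun n =>
    (h n).imp fun _ hj => hj.le
  exact hB.not_isStrictlySingular S hε (fun n => hu1 (φ n)) (hu.comp hφ)
    (fun n => (h' n).elim fun j hj => hj.trans (B.norm_coord_le _ _)) (Or.inl h') hS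

theorem IsSchreierLike.tendsto_apply (hB : B.IsSchreierLike) {S : Op 𝕜 E}
    (hS : IsStrictlySingular S) {u : ℕ → E} (hu1 : ∀ n, ‖u n‖ ≤ 1) (hu : B.SupNull u) :
    Tendsto (fun n => S (u n)) atTop (𝓝 0) := by
  by_contra hcon
  rw [NormedAddGroup.tendsto_nhds_zero] at hcon
  push Not at hcon
  obtain ⟨δ, hδ, hfr⟩ := hcon
  obtain ⟨φ, hφ, h⟩ := extraction_of_frequently_atTop hfr
  exact hB.not_isStrictlySingular S hδ (fun n => hu1 (φ n)) (hu.coordNull.comp hφ)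
    h (Or.inr (hu.comp hφ)) hS

/-! ### Compact operators -/

/-- If convergence fails, near-norming vectors of the differences, with their first `φ n`
coordinates removed, form a coordinatewise null sequence in the unit ball on which `T` stays large.
-/
theorem tendsto_comp_proj_of_forall_coordNull (T : Op 𝕜 E)
    (hT : ∀ u : ℕ → E, (∀ n, ‖u n‖ ≤ 1) → B.CoordNull u → ∀ δ > 0, ∃ n, ‖T (u n)‖ < δ) :
    Tendsto (fun n => T ∘L B.proj (Finset.range n)) atTop (𝓝 T) := by
  rw [tendsto_iff_norm_sub_tendsto_zero, NormedAddGroup.tendsto_nhds_zero]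
  by_contra! hcon
  obtain ⟨δ, hδ, hfr⟩ := hcon
  obtain ⟨φ, hφ, h⟩ := extraction_of_frequently_atTop hfr
  have hx : ∀ n, ∃ x, ‖x‖ ≤ 1 ∧ δ / 2 ≤ ‖T (x - B.proj (Finset.range (φ n)) x)‖ := fun n => by
    have h1 : δ / 2 < ‖T ∘L B.proj (Finset.range (φ n)) - T‖ := by
      have := h n
      rw [norm_norm] at this
      linarith
    obtain ⟨x, hx1, hx2⟩ := ContinuousLinearMap.exists_lt_apply_of_lt_opNorm _ h1
    refine ⟨x, hx1.le, hx2.le.trans_eq ?_⟩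
    rw [map_sub, norm_sub_rev]
    rfl
  choose x hx1 hx2 using hx
  obtain ⟨n, hn⟩ := hT (fun n => x n - B.proj (Finset.range (φ n)) (x n))
    (fun n => (B.norm_sub_proj_apply_le _ _).trans (hx1 n)) (fun j => by
      refine tendsto_const_nhds.congr' ?_
      filter_upwards [hφ.tendsto_atTop.eventually_gt_atTop j] with n hn
      rw [map_sub, coord_proj, if_pos (Finset.mem_range.2 hn), sub_self]) (δ / 2) (by positivity)
  exact absurd (hx2 n) (not_le.2 hn)

theorem isCompactOperator_of_tendsto_comp_proj [CompleteSpace E] {T : Op 𝕜 E}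
    (hT : Tendsto (fun n => T ∘L B.proj (Finset.range n)) atTop (𝓝 T)) : IsCompactOperator T :=
  isCompactOperator_of_tendsto hT <|
    Eventually.of_forall fun n => (B.isCompactOperator_proj (Finset.range n)).clm_comp T

theorem IsSchreierLike.isCompactOperator_comp [CompleteSpace E] (hB : B.IsSchreierLike)
    {T U : Op 𝕜 E} (hT : IsStrictlySingular T) (hU : IsStrictlySingular U) :
    IsCompactOperator (T ∘L U) := by
  refine isCompactOperator_of_tendsto_comp_proj
    (tendsto_comp_proj_of_forall_coordNull (B := B) _ fun u hu1 hu δ hδ => ?_)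
  -- Scaling by the inverse of `‖U‖ + 1` keeps both the vectors and their images under `U` in the
  -- unit ball, even if `U = 0`.
  have hc : 0 < ‖U‖ + 1 := by positivity
  have hnorm : ‖(((‖U‖ + 1)⁻¹ : ℝ) : 𝕜)‖ = (‖U‖ + 1)⁻¹ := by
    rw [RCLike.norm_ofReal, abs_of_pos (by positivity)]
  have hcu1 : ∀ n, ‖(((‖U‖ + 1)⁻¹ : ℝ) : 𝕜) • u n‖ ≤ 1 := fun n => by
    rw [norm_smul, hnorm]
    exact mul_le_one₀ (inv_le_one_of_one_le₀ (by linarith [norm_nonneg U])) (norm_nonneg _)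
      (hu1 n)
  have h1 := hB.supNull_apply hU hcu1 fun j => by
    simpa using (hu j).const_mul (((‖U‖ + 1)⁻¹ : ℝ) : 𝕜)
  have h2 := hB.tendsto_apply hT (fun n => by
    rw [map_smul, norm_smul, hnorm, inv_mul_le_iff₀ hc, mul_one]
    refine (U.le_opNorm _).trans ?_
    nlinarith [hu1 n, norm_nonneg U, norm_nonneg (u n)]) h1
  rw [NormedAddGroup.tendsto_nhds_zero] at h2
  obtain ⟨n, hn⟩ := (h2 (δ * (‖U‖ + 1)⁻¹) (by positivity)).exists
  refine ⟨n, ?_⟩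
  rw [map_smul, map_smul, norm_smul, hnorm, mul_comm] at hn
  exact lt_of_mul_lt_mul_right hn (by positivity)

theorem _root_.IsCompactOperator.exists_tendsto_subseq {T : Op 𝕜 E} (hT : IsCompactOperator T)
    {u : ℕ → E} (hu : ∀ n, ‖u n‖ ≤ 1) :
    ∃ (w : E) (φ : ℕ → ℕ), StrictMono φ ∧ Tendsto (fun n => T (u (φ n))) atTop (𝓝 w) := by
  obtain ⟨K, hK, hsub⟩ := IsCompactOperator.image_closedBall_subset_compact
    (f := (T : E →ₗ[𝕜] E)) hT 1
  obtain ⟨w, -, φ, hφ, hw⟩ := hK.tendsto_subseq (x := fun n => T (u n)) fun n =>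
    hsub ⟨u n, by simpa using hu n, rfl⟩
  exact ⟨w, φ, hφ, hw⟩

theorem IsSchreierLike.tendsto_comp_proj (hB : B.IsSchreierLike) {T : Op 𝕜 E}
    (hT : IsCompactOperator T) :
    Tendsto (fun n => T ∘L B.proj (Finset.range n)) atTop (𝓝 T) := by
  refine tendsto_comp_proj_of_forall_coordNull T fun u hu1 hu δ hδ => ?_
  obtain ⟨w, φ, hφ, hw⟩ := hT.exists_tendsto_subseq hu1
  -- Weak nullity of `u` makes the images coordinatewise null, so a norm limit has no nonzero
  -- coordinate.
  have hw0 : w = 0 := B.eq_zero_of_coord fun j =>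
    tendsto_nhds_unique (((B.coord j).continuous.tendsto w).comp hw)
      ((hB.coordNull_apply T hu1 hu).comp hφ j)
  subst hw0
  rw [NormedAddGroup.tendsto_nhds_zero] at hw
  obtain ⟨n, hn⟩ := (hw δ hδ).exists
  exact ⟨φ n, hn⟩

variable (B) in
-- The projections are uniformly bounded and converge pointwise, hence uniformly on the relatively
-- compact image of the unit ball.
theorem tendsto_proj_comp {T : Op 𝕜 E} (hT : IsCompactOperator T) :
    Tendsto (fun n => B.proj (Finset.range n) ∘L T) atTop (𝓝 T) := by
  rw [tendsto_iff_norm_sub_tendsto_zero, NormedAddGroup.tendsto_nhds_zero]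
  by_contra! hcon
  obtain ⟨δ, hδ, hfr⟩ := hcon
  obtain ⟨φ, hφ, h⟩ := extraction_of_frequently_atTop hfr
  have hx : ∀ n, ∃ x, ‖x‖ ≤ 1 ∧ δ / 2 ≤ ‖T x - B.proj (Finset.range (φ n)) (T x)‖ := fun n => by
    have h1 : δ / 2 < ‖B.proj (Finset.range (φ n)) ∘L T - T‖ := by
      have := h n
      rw [norm_norm] at this
      linarith
    obtain ⟨x, hx1, hx2⟩ := ContinuousLinearMap.exists_lt_apply_of_lt_opNorm _ h1
    refine ⟨x, hx1.le, hx2.le.trans_eq ?_⟩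
    rw [norm_sub_rev]
    rfl
  choose x hx1 hx2 using hx
  obtain ⟨w, ψ, hψ, hw⟩ := hT.exists_tendsto_subseq hx1
  have h1 : Tendsto (fun n => ‖w - B.proj (Finset.range (φ (ψ n))) w‖) atTop (𝓝 0) := by
    have := (tendsto_const_nhds (x := w)).sub
      ((B.tendsto_proj w).comp (hφ.comp hψ).tendsto_atTop) |>.norm
    simpa using this
  rw [tendsto_iff_norm_sub_tendsto_zero] at hw
  obtain ⟨n, h1, h2⟩ := ((h1.eventually_lt_const (show 0 < δ / 4 by positivity)).and
    (hw.eventually_lt_const (show 0 < δ / 4 by positivity))).exists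
  have h3 := hx2 (ψ n)
  have h4 := B.norm_sub_proj_apply_le (Finset.range (φ (ψ n))) (T (x (ψ n)) - w)
  have h5 : T (x (ψ n)) - B.proj (Finset.range (φ (ψ n))) (T (x (ψ n))) =
      (T (x (ψ n)) - w - B.proj (Finset.range (φ (ψ n))) (T (x (ψ n)) - w)) +
      (w - B.proj (Finset.range (φ (ψ n))) w) := by
    rw [map_sub]
    abel
  rw [h5] at h3
  have h6 := h3.trans (norm_add_le _ _)
  linarith

/-! ### Ideals -/

variable (B) in
theorem proj_mem_of_ne_bot {I : TwoSidedIdeal (Op 𝕜 E)} (hI : I ≠ ⊥) (s : Finset ℕ) :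
    B.proj s ∈ I := by
  have hT : ∃ T ∈ I, T ≠ 0 := by
    by_contra! h
    refine hI (le_antisymm (fun T hT => ?_) bot_le)
    rw [h T hT]
    exact TwoSidedIdeal.zero_mem _
  obtain ⟨T, hT, hT0⟩ := hT
  obtain ⟨x, hx⟩ : ∃ x, T x ≠ 0 := by
    by_contra! h
    exact hT0 (ContinuousLinearMap.ext h)
  obtain ⟨j, hj⟩ : ∃ j, B.coord j (T x) ≠ 0 := by
    by_contra! h
    exact hx (B.eq_zero_of_coord h)
  refine sum_mem fun k _ => ?_
  -- Each rank-one diagonal operator factors through `T`: `e_k` is sent to `x`, and the nonzero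
  -- `j`-th coordinate of `T x` is read off and normalized.
  have h : (B.coord k).smulRight (B.vec k) =
      (B.coord j).smulRight ((B.coord j (T x))⁻¹ • B.vec k) * T * (B.coord k).smulRight x := by
    ext y
    simp [smul_smul, hj]
  rw [h]
  exact I.mul_mem_right _ _ (I.mul_mem_left _ _ hT)

theorem IsSchreierLike.eq_compactOps [CompleteSpace E] (hB : B.IsSchreierLike)
    {I : TwoSidedIdeal (Op 𝕜 E)} (hcl : IsClosed (I : Set (Op 𝕜 E))) (hI : IsSmall I)
    (h0 : I ≠ ⊥) {l : Filter (Op 𝕜 E)}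
    (hl : IsLeftApproxIdentity (I : Set (Op 𝕜 E)) l ∨
      IsRightApproxIdentity (I : Set (Op 𝕜 E)) l) :
    (I : Set (Op 𝕜 E)) = compactOps 𝕜 E := by
  refine Set.Subset.antisymm (fun T hT => ?_) fun T hT => ?_
  · rcases hl with hl | hl
    · have := hl.neBot
      exact isCompactOperator_of_tendsto (hl.tendsto T hT) <| hl.eventually_mem.mono
        fun A hA => hB.isCompactOperator_comp (hI A hA) (hI T hT)
    · have := hl.neBot
      exact isCompactOperator_of_tendsto (hl.tendsto T hT) <| hl.eventually_mem.mono
        fun A hA => hB.isCompactOperator_comp (hI T hT) (hI A hA)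
  · exact hcl.mem_of_tendsto (B.tendsto_proj_comp hT) <| Eventually.of_forall fun n =>
      I.mul_mem_right _ _ (B.proj_mem_of_ne_bot h0 _)

theorem IsSchreierLike.exists_approxIdentity (hB : B.IsSchreierLike) :
    ∃ l : Filter (Op 𝕜 E), IsLeftApproxIdentity (compactOps 𝕜 E) l ∧
      IsRightApproxIdentity (compactOps 𝕜 E) l ∧ ∀ᶠ A in l, ‖A‖ ≤ 1 := by
  have hmem : ∀ᶠ A in map (fun n => B.proj (Finset.range n)) atTop, A ∈ compactOps 𝕜 E :=
    eventually_map.2 <| Eventually.of_forall fun n => B.isCompactOperator_proj _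
  exact ⟨map (fun n => B.proj (Finset.range n)) atTop,
    ⟨inferInstance, hmem, fun T hT => tendsto_map'_iff.2 (B.tendsto_proj_comp hT)⟩,
    ⟨inferInstance, hmem, fun T hT => tendsto_map'_iff.2 (hB.tendsto_comp_proj hT)⟩,
    eventually_map.2 <| Eventually.of_forall fun n => B.norm_proj_le _⟩

end UnitBasis

/-! ### Schreier sets and partitions into intervals -/

theorem IsSchreier.subset {F G : Finset ℕ} (hF : IsSchreier F) (h : G ⊆ F) : IsSchreier G :=
  fun n hn => (Finset.card_le_card h).trans (hF n (h hn))

/-- The index of the first interval that meets `F`. -/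
def headIndex (N : ℕ → ℕ) (F : Finset ℕ) : ℕ := sInf {n | ∃ j ∈ F, blockIndex N j = n}

/-- The part of `F` in the first interval that it meets. -/
def headPart (N : ℕ → ℕ) (F : Finset ℕ) : Finset ℕ :=
  F.filter fun j => blockIndex N j = headIndex N F

/-- The part of `F` outside the first interval that it meets. -/
def tailPart (N : ℕ → ℕ) (F : Finset ℕ) : Finset ℕ :=
  F.filter fun j => headIndex N F < blockIndex N j

section HeadTail

variable {N : ℕ → ℕ} {F : Finset ℕ}

theorem headIndex_le {j : ℕ} (hj : j ∈ F) : headIndex N F ≤ blockIndex N j :=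
  Nat.sInf_le ⟨j, hj, rfl⟩

theorem exists_blockIndex_eq_headIndex (hF : F.Nonempty) :
    ∃ j ∈ F, blockIndex N j = headIndex N F :=
  Nat.sInf_mem (s := {n | ∃ j ∈ F, blockIndex N j = n}) (hF.elim fun j hj => ⟨_, j, hj, rfl⟩)

theorem headPart_subset : headPart N F ⊆ F := Finset.filter_subset _ _

theorem tailPart_subset : tailPart N F ⊆ F := Finset.filter_subset _ _

theorem sum_headPart_add_sum_tailPart (g : ℕ → ℝ) :
    ∑ j ∈ headPart N F, g j + ∑ j ∈ tailPart N F, g j = ∑ j ∈ F, g j := by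
  rw [← Finset.sum_filter_add_sum_filter_not F (fun j => blockIndex N j = headIndex N F) g]
  congr 1
  refine Finset.sum_congr (Finset.filter_congr fun j hj => ?_) fun _ _ => rfl
  have := headIndex_le (N := N) hj
  omega

/-- The head contains some `i ∈ F`, so the tail has fewer than `F.card ≤ i + 1` points, and `i` lies
to the left of every interval meeting the tail. -/
theorem card_tailPart_le (hN : StrictMono N) (hF : IsSchreier F) {j : ℕ}
    (hj : j ∈ tailPart N F) : (tailPart N F).card ≤ N (blockIndex N j) := by
  have hne : F.Nonempty := ⟨j, tailPart_subset hj⟩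
  obtain ⟨i, hi, hib⟩ := exists_blockIndex_eq_headIndex (N := N) hne
  have hlt : blockIndex N i < blockIndex N j := by
    rw [hib]
    exact (Finset.mem_filter.1 hj).2
  have h1 : (tailPart N F).card < F.card := by
    refine Finset.card_lt_card ⟨tailPart_subset, fun h => ?_⟩
    have := (Finset.mem_filter.1 (h hi)).2
    omega
  have h2 := hF i hi
  have h3 := (lt_of_blockIndex_lt hN hlt).1
  omega

/-- An interval that meets both `F` and a later `G` can only be the head interval of `G`. Hence
tails of distinct chain members meet disjoint sets of intervals. -/
theorem blockIndex_lt_of_tailPart (hN : StrictMono N) {G : Finset ℕ}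
    (h : ∀ m ∈ F, ∀ n ∈ G, m < n) {i j : ℕ} (hi : i ∈ tailPart N F) (hj : j ∈ tailPart N G) :
    blockIndex N i < blockIndex N j := by
  obtain ⟨k, hk, hkb⟩ := exists_blockIndex_eq_headIndex (N := N) (F := G) ⟨j, tailPart_subset hj⟩
  have h1 := blockIndex_mono hN (h i (tailPart_subset hi) k hk).le
  have h2 := (Finset.mem_filter.1 hj).2
  omega

/-- The Schreier set of the points `k n`, where `n` runs through the indices of the intervals
beyond the first one that meet `F`. -/
theorem isSchreier_image_tailPart (hN : StrictMono N) (hF : IsSchreier F) {k : ℕ → ℕ}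
    (hk : ∀ n, N n ≤ k n) :
    IsSchreier (((tailPart N F).image (blockIndex N)).image k) := by
  intro m hm
  obtain ⟨n, hn, rfl⟩ := Finset.mem_image.1 hm
  obtain ⟨j, hj, rfl⟩ := Finset.mem_image.1 hn
  have h1 := card_tailPart_le hN hF hj
  have h2 := hk (blockIndex N j)
  have h3 := Finset.card_image_le (s := (tailPart N F).image (blockIndex N)) (f := k)
  have h4 := Finset.card_image_le (s := tailPart N F) (f := blockIndex N)
  omega

end HeadTail

/-! ### Coefficients and coordinates of block sums -/

/-- The absolute values of the coefficients in a sum over `s`, extended by zero. -/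
def weight {𝕜 : Type*} [RCLike 𝕜] (s : Finset ℕ) (a : ℕ → 𝕜) (n : ℕ) : ℝ :=
  if n ∈ s then ‖a n‖ else 0

section Weight

variable {𝕜 : Type*} [RCLike 𝕜] {s : Finset ℕ} {a : ℕ → 𝕜}

theorem weight_nonneg (n : ℕ) : 0 ≤ weight s a n := by
  unfold weight
  split_ifs <;> positivity

theorem weight_le {A : ℝ} (hA : 0 ≤ A) (h : ∀ n ∈ s, ‖a n‖ ≤ A) (n : ℕ) : weight s a n ≤ A := by
  unfold weight
  split_ifs with hn
  exacts [h n hn, hA]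

theorem sum_weight_rpow_le {p : ℝ} (hp : 1 ≤ p) (J : Finset ℕ) :
    ∑ n ∈ J, weight s a n ^ p ≤ ∑ n ∈ s, ‖a n‖ ^ p := by
  have h : ∀ n, weight s a n ^ p = if n ∈ s then ‖a n‖ ^ p else 0 := fun n => by
    unfold weight
    split_ifs
    exacts [rfl, Real.zero_rpow (by linarith)]
  simp only [h]
  rw [← Finset.sum_filter]
  exact Finset.sum_le_sum_of_subset_of_nonneg (fun n hn => (Finset.mem_filter.1 hn).2)
    fun _ _ _ => by positivity

end Weight

namespace UnitBasis

variable {𝕜 E : Type*} [RCLike 𝕜] [NormedAddCommGroup E] [NormedSpace 𝕜 E] {B : UnitBasis 𝕜 E}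
variable {p : ℝ} {N : ℕ → ℕ} {u v : ℕ → E}

theorem IsBlock.norm_coord_sum (hN : StrictMono N) (hu : B.IsBlock N u) (s : Finset ℕ)
    (a : ℕ → 𝕜) (j : ℕ) : ‖B.coord j (∑ n ∈ s, a n • u n)‖ =
      weight s a (blockIndex N j) * ‖B.coord j (u (blockIndex N j))‖ := by
  rw [hu.coord_sum hN, weight]
  split_ifs <;> simp

/-- Peaks of a block sequence. -/
theorem IsBlock.exists_peaks (hv : B.IsBlock N v) (h : ∀ n, ∃ j, 1 ≤ ‖B.coord j (v n)‖) :
    ∃ k : ℕ → ℕ, (∀ n, k n ∈ Finset.Ico (N n) (N (n + 1))) ∧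
      ∀ n, 1 ≤ ‖B.coord (k n) (v n)‖ := by
  choose k hk using h
  refine ⟨k, fun n => ?_, hk⟩
  by_contra hn
  have := hk n
  rw [hv n _ hn, norm_zero] at this
  linarith

theorem IsBlock.weight_le_norm_coord (hN : StrictMono N) (hv : B.IsBlock N v) {k : ℕ → ℕ}
    (hk : ∀ n, k n ∈ Finset.Ico (N n) (N (n + 1))) (hk1 : ∀ n, 1 ≤ ‖B.coord (k n) (v n)‖)
    (s : Finset ℕ) (a : ℕ → 𝕜) (n : ℕ) :
    weight s a n ≤ ‖B.coord (k n) (∑ n ∈ s, a n • v n)‖ := by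
  rw [hv.norm_coord_sum hN, blockIndex_eq hN (hk n)]
  exact le_mul_of_one_le_right (weight_nonneg n) (hk1 n)

theorem IsBlock.weight_le_norm (hN : StrictMono N) (hv : B.IsBlock N v) (hv1 : ∀ n, 1 ≤ ‖v n‖)
    (s : Finset ℕ) (a : ℕ → 𝕜) (n : ℕ) : weight s a n ≤ ‖∑ n ∈ s, a n • v n‖ :=
  weight_le (norm_nonneg _) (fun n hn =>
    (le_mul_of_one_le_right (norm_nonneg _) (hv1 n)).trans (hv.norm_mul_le hN s a hn)) n

/-- Flatness bounds each term by the reciprocal of the cardinality of the tail. -/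
theorem sum_tailPart_le_one (hN : StrictMono N) (hs : ∀ n j, N n * ‖B.coord j (u n)‖ ≤ 1)
    {F : Finset ℕ} (hF : IsSchreier F) :
    ∑ j ∈ tailPart N F, ‖B.coord j (u (blockIndex N j))‖ ≤ 1 := by
  rcases (tailPart N F).eq_empty_or_nonempty with h | h
  · simp [h]
  have hc : (0 : ℝ) < (tailPart N F).card := by exact_mod_cast h.card_pos
  calc _ ≤ (tailPart N F).card • ((tailPart N F).card : ℝ)⁻¹ := by
        refine Finset.sum_le_card_nsmul _ _ _ fun j hj => ?_
        rw [← one_div, le_div_iff₀' hc]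
        refine le_trans ?_ (hs (blockIndex N j) j)
        gcongr
        exact card_tailPart_le hN hF hj
    _ = 1 := by rw [nsmul_eq_mul, mul_inv_cancel₀ hc.ne']

theorem injective_of_mem_Ico (hN : StrictMono N) {k : ℕ → ℕ}
    (hk : ∀ n, k n ∈ Finset.Ico (N n) (N (n + 1))) : Function.Injective k := fun m n h => by
  rw [← blockIndex_eq hN (hk m), h, blockIndex_eq hN (hk n)]

/-! ### Schreier norms -/

variable (B p) in
/-- The norm is the supremum of `(∑_{n ∈ F} |x(n)|^p)^{1/p}` over the Schreier sets `F`. -/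
structure IsSchreierNorm : Prop where
  sum_le : ∀ (x : E) (F : Finset ℕ), IsSchreier F → ∑ j ∈ F, ‖B.coord j x‖ ^ p ≤ ‖x‖ ^ p
  norm_le : ∀ (x : E) (c : ℝ), 0 ≤ c →
    (∀ F : Finset ℕ, IsSchreier F → ∑ j ∈ F, ‖B.coord j x‖ ^ p ≤ c ^ p) → ‖x‖ ≤ c

namespace IsSchreierNorm

theorem sum_block_le (hB : B.IsSchreierNorm p) (hp : 1 ≤ p) (hN : StrictMono N)
    (hu : B.IsBlock N u) (hu1 : ∀ n, ‖u n‖ ≤ 1) (s : Finset ℕ) (a : ℕ → 𝕜) {F : Finset ℕ}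
    (hF : IsSchreier F) {n : ℕ} (hn : ∀ j ∈ F, blockIndex N j = n) :
    ∑ j ∈ F, ‖B.coord j (∑ n ∈ s, a n • u n)‖ ^ p ≤ weight s a n ^ p := by
  calc _ = weight s a n ^ p * ∑ j ∈ F, ‖B.coord j (u n)‖ ^ p := by
        rw [Finset.mul_sum]
        refine Finset.sum_congr rfl fun j hj => ?_
        rw [hu.norm_coord_sum hN, hn j hj, Real.mul_rpow (weight_nonneg n) (norm_nonneg _)]
    _ ≤ weight s a n ^ p * 1 := by
        refine mul_le_mul_of_nonneg_left ?_ (Real.rpow_nonneg (weight_nonneg n) _)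
        exact (hB.sum_le (u n) F hF).trans
          (Real.rpow_le_one (norm_nonneg _) (hu1 n) (by linarith))
    _ = _ := mul_one _

theorem norm_sum_le_of_tail (hB : B.IsSchreierNorm p) (hp : 1 ≤ p) (hN : StrictMono N)
    (hu : B.IsBlock N u) (hu1 : ∀ n, ‖u n‖ ≤ 1) (s : Finset ℕ) (a : ℕ → 𝕜) {A : ℝ} (hA0 : 0 ≤ A)
    (hA : ∀ n, weight s a n ≤ A)
    (htail : ∀ F, IsSchreier F →
      ∑ j ∈ tailPart N F, ‖B.coord j (∑ n ∈ s, a n • u n)‖ ^ p ≤ A ^ p) :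
    ‖∑ n ∈ s, a n • u n‖ ≤ 2 * A := by
  refine hB.norm_le _ _ (by positivity) fun F hF => ?_
  have h1 : ∑ j ∈ headPart N F, ‖B.coord j (∑ n ∈ s, a n • u n)‖ ^ p ≤ A ^ p :=
    (hB.sum_block_le hp hN hu hu1 s a (hF.subset headPart_subset)
      fun j hj => (Finset.mem_filter.1 hj).2).trans
      (Real.rpow_le_rpow (weight_nonneg _) (hA _) (by linarith))
  rw [← sum_headPart_add_sum_tailPart (N := N), Real.mul_rpow zero_le_two hA0]
  -- Head and tail together give `2 * A ^ p`, which is at most `(2 * A) ^ p` as `1 ≤ p`.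
  have h2 : (2 : ℝ) ≤ 2 ^ p := by simpa using Real.rpow_le_rpow_of_exponent_le one_le_two hp
  nlinarith [htail F hF, Real.rpow_nonneg hA0 p]

theorem norm_sum_le_of_small (hB : B.IsSchreierNorm p) (hp : 1 ≤ p) (hN : StrictMono N)
    (hu : B.IsBlock N u) (hu1 : ∀ n, ‖u n‖ ≤ 1) (hs : ∀ n j, N n * ‖B.coord j (u n)‖ ≤ 1)
    (s : Finset ℕ) (a : ℕ → 𝕜) {A : ℝ} (hA0 : 0 ≤ A) (hA : ∀ n, weight s a n ≤ A) :
    ‖∑ n ∈ s, a n • u n‖ ≤ 2 * A := by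
  refine hB.norm_sum_le_of_tail hp hN hu hu1 s a hA0 hA fun F hF => ?_
  calc _ ≤ ∑ j ∈ tailPart N F, A ^ p * ‖B.coord j (u (blockIndex N j))‖ := by
        refine Finset.sum_le_sum fun j _ => ?_
        rw [hu.norm_coord_sum hN, Real.mul_rpow (weight_nonneg _) (norm_nonneg _)]
        refine mul_le_mul (Real.rpow_le_rpow (weight_nonneg _) (hA _) (by linarith)) ?_
          (by positivity) (by positivity)
        exact Real.rpow_le_self_of_le_one (norm_nonneg _)
          ((B.norm_coord_le _ _).trans (hu1 _)) hp
    _ ≤ A ^ p * 1 := by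
        rw [← Finset.mul_sum]
        exact mul_le_mul_of_nonneg_left (sum_tailPart_le_one hN hs hF) (by positivity)
    _ = _ := mul_one _

theorem isSchreierLike (hB : B.IsSchreierNorm p) (hp : 1 ≤ p) : B.IsSchreierLike where
  norm_sum_le_of_coord N u v hN hu hv hu1 hv1 s a := by
    obtain ⟨k, hk, hk1⟩ := hv.exists_peaks hv1
    have hA := hv.weight_le_norm hN (fun n => (hk1 n).trans (B.norm_coord_le _ _)) s a
    refine (hB.norm_sum_le_of_tail hp hN hu hu1 s a (norm_nonneg _) hA fun F hF => ?_).trans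
      (mul_le_mul_of_nonneg_right (by norm_num) (norm_nonneg _))
    -- Within each interval of the tail, the mass of `u` is replaced by the peak of `v` there; the
    -- peaks form a Schreier set.
    rw [← Finset.sum_fiberwise_of_maps_to (t := (tailPart N F).image (blockIndex N))
      (fun j hj => Finset.mem_image_of_mem _ hj)]
    calc _ ≤ ∑ n ∈ (tailPart N F).image (blockIndex N), weight s a n ^ p :=
          Finset.sum_le_sum fun n _ => hB.sum_block_le hp hN hu hu1 s a
            ((hF.subset tailPart_subset).subset (Finset.filter_subset _ _))
            fun j hj => (Finset.mem_filter.1 hj).2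
      _ ≤ ∑ n ∈ (tailPart N F).image (blockIndex N),
          ‖B.coord (k n) (∑ n ∈ s, a n • v n)‖ ^ p :=
          Finset.sum_le_sum fun n _ => Real.rpow_le_rpow (weight_nonneg _)
            (hv.weight_le_norm_coord hN hk hk1 s a n) (by linarith)
      _ = ∑ j ∈ ((tailPart N F).image (blockIndex N)).image k,
          ‖B.coord j (∑ n ∈ s, a n • v n)‖ ^ p := by
          rw [Finset.sum_image (injective_of_mem_Ico hN hk).injOn]
      _ ≤ _ := hB.sum_le _ _ (isSchreier_image_tailPart hN hF
          fun n => (Finset.mem_Ico.1 (hk n)).1)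
  norm_sum_le_of_small N u v hN hu hv hu1 hs hv1 s a :=
    (hB.norm_sum_le_of_small hp hN hu hu1 hs s a (norm_nonneg _)
      (hv.weight_le_norm hN hv1 s a)).trans
      (mul_le_mul_of_nonneg_right (by norm_num) (norm_nonneg _))
  exists_norm_sum_le η hη := by
    obtain ⟨k, hk⟩ := exists_nat_gt (2 / η)
    have hk0 : (0 : ℝ) < k := lt_trans (by positivity) hk
    refine ⟨k, by exact_mod_cast hk0, fun N u hN hu hu1 hs => ?_⟩
    have h := hB.norm_sum_le_of_small hp hN hu hu1 hs (Finset.range k) (fun _ => (1 : 𝕜))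
      zero_le_one (weight_le zero_le_one fun n _ => by simp)
    simp only [one_smul] at h
    rw [div_lt_iff₀ hη] at hk
    linarith

end IsSchreierNorm

/-! ### Baernstein norms -/

variable (B p) in
/-- The norm is the supremum of `(∑_{F ∈ C} (∑_{n ∈ F} |x(n)|)^p)^{1/p}` over the Schreier
chains `C`. -/
structure IsBaernsteinNorm : Prop where
  sum_le : ∀ (x : E) (C : Finset (Finset ℕ)), IsSchreierChain C →
    ∑ F ∈ C, (∑ j ∈ F, ‖B.coord j x‖) ^ p ≤ ‖x‖ ^ p
  norm_le : ∀ (x : E) (c : ℝ), 0 ≤ c → (∀ C : Finset (Finset ℕ), IsSchreierChain C →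
    ∑ F ∈ C, (∑ j ∈ F, ‖B.coord j x‖) ^ p ≤ c ^ p) → ‖x‖ ≤ c

end UnitBasis

theorem real_rpow_add_le_mul_rpow_add_rpow {x y p : ℝ} (hx : 0 ≤ x) (hy : 0 ≤ y) (hp : 1 ≤ p) :
    (x + y) ^ p ≤ 2 ^ (p - 1) * (x ^ p + y ^ p) := by
  lift x to NNReal using hx
  lift y to NNReal using hy
  exact_mod_cast NNReal.rpow_add_le_mul_rpow_add_rpow x y hp

/-- Sums over a Schreier chain bound sums over families of consecutive Schreier sets, some of
which may be empty. -/
theorem sum_family_le {ι : Type*} {p : ℝ} (hp : 1 ≤ p) (g : ℕ → ℝ) {K : ℝ} (hK : 0 ≤ K)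
    (hg : ∀ C, IsSchreierChain C → ∑ F ∈ C, (∑ j ∈ F, g j) ^ p ≤ K) (t : Finset ι)
    (f : ι → Finset ℕ) (hf : ∀ i ∈ t, IsSchreier (f i))
    (hsep : ∀ i ∈ t, ∀ i' ∈ t, i ≠ i' →
      (∀ m ∈ f i, ∀ n ∈ f i', m < n) ∨ (∀ m ∈ f i, ∀ n ∈ f i', n < m)) :
    ∑ i ∈ t, (∑ j ∈ f i, g j) ^ p ≤ K := by
  classical
  have h0 : ∑ i ∈ t.filter (fun i => (f i).Nonempty), (∑ j ∈ f i, g j) ^ p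
      = ∑ i ∈ t, (∑ j ∈ f i, g j) ^ p := by
    refine Finset.sum_filter_of_ne fun i _ hi => ?_
    by_contra h
    rw [Finset.not_nonempty_iff_eq_empty] at h
    rw [h, Finset.sum_empty, Real.zero_rpow (by linarith)] at hi
    exact hi rfl
  rw [← h0]
  set t' := t.filter (fun i => (f i).Nonempty) with ht'
  have hmem : ∀ i ∈ t', i ∈ t ∧ (f i).Nonempty := fun i hi => Finset.mem_filter.1 hi
  have hinj : Set.InjOn f t' := fun i hi i' hi' h => by
    by_contra hne
    obtain ⟨j, hj⟩ := (hmem i hi).2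
    have hj' : j ∈ f i' := h ▸ hj
    rcases hsep i (hmem i hi).1 i' (hmem i' hi').1 hne with h1 | h1 <;>
      exact lt_irrefl _ (h1 j hj j hj')
  rcases t'.eq_empty_or_nonempty with h | h
  · simpa [h] using hK
  rw [← Finset.sum_image (f := fun F => (∑ j ∈ F, g j) ^ p) hinj]
  refine hg _ ⟨h.image f, fun F hF => ?_, fun F hF => ?_, fun F hF G hG hne => ?_⟩
  · obtain ⟨i, hi, rfl⟩ := Finset.mem_image.1 hF
    exact (hmem i hi).2
  · obtain ⟨i, hi, rfl⟩ := Finset.mem_image.1 hF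
    exact hf i (hmem i hi).1
  · obtain ⟨i, hi, rfl⟩ := Finset.mem_image.1 hF
    obtain ⟨i', hi', rfl⟩ := Finset.mem_image.1 hG
    exact hsep i (hmem i hi).1 i' (hmem i' hi').1 fun h => hne (h ▸ rfl)

namespace UnitBasis.IsBaernsteinNorm

variable {𝕜 E : Type*} [RCLike 𝕜] [NormedAddCommGroup E] [NormedSpace 𝕜 E] {B : UnitBasis 𝕜 E}
variable {p : ℝ} {N : ℕ → ℕ} {u v : ℕ → E}

theorem sum_family_le {ι : Type*} (hB : B.IsBaernsteinNorm p) (hp : 1 ≤ p) (x : E) (t : Finset ι)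
    (f : ι → Finset ℕ) (hf : ∀ i ∈ t, IsSchreier (f i))
    (hsep : ∀ i ∈ t, ∀ i' ∈ t, i ≠ i' →
      (∀ m ∈ f i, ∀ n ∈ f i', m < n) ∨ (∀ m ∈ f i, ∀ n ∈ f i', n < m)) :
    ∑ i ∈ t, (∑ j ∈ f i, ‖B.coord j x‖) ^ p ≤ ‖x‖ ^ p :=
  SchreierBaernstein.sum_family_le hp _ (by positivity) (hB.sum_le x) t f hf hsep

theorem sum_schreier_le (hB : B.IsBaernsteinNorm p) (hp : 1 ≤ p) (x : E) {F : Finset ℕ}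
    (hF : IsSchreier F) : ∑ j ∈ F, ‖B.coord j x‖ ≤ ‖x‖ := by
  have h := hB.sum_family_le hp x {()} (fun _ => F) (fun _ _ => hF)
    fun i _ i' _ h => absurd rfl h
  rw [Finset.sum_singleton] at h
  exact (Real.rpow_le_rpow_iff (Finset.sum_nonneg fun _ _ => norm_nonneg _) (norm_nonneg _)
    (by linarith)).1 h

/-- Heads sharing the index `n` are consecutive Schreier sets evaluated on the single block `u n`,
so together they contribute at most the `p`-th power of its weight. -/
theorem sum_headPart_le (hB : B.IsBaernsteinNorm p) (hp : 1 ≤ p) (hN : StrictMono N)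
    (hu : B.IsBlock N u) (hu1 : ∀ n, ‖u n‖ ≤ 1) (s : Finset ℕ) (a : ℕ → 𝕜)
    {C : Finset (Finset ℕ)} (hC : IsSchreierChain C) :
    ∑ F ∈ C, (∑ j ∈ headPart N F, ‖B.coord j (∑ n ∈ s, a n • u n)‖) ^ p
      ≤ ∑ n ∈ s, ‖a n‖ ^ p := by
  rw [← Finset.sum_fiberwise_of_maps_to (t := C.image (headIndex N))
    (fun F hF => Finset.mem_image_of_mem _ hF)]
  refine le_trans (Finset.sum_le_sum fun n _ => ?_) (sum_weight_rpow_le hp (C.image (headIndex N)))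
  calc _ = weight s a n ^ p * ∑ F ∈ C.filter (fun F => headIndex N F = n),
        (∑ j ∈ headPart N F, ‖B.coord j (u n)‖) ^ p := by
        rw [Finset.mul_sum]
        refine Finset.sum_congr rfl fun F hF => ?_
        rw [← Real.mul_rpow (weight_nonneg n) (Finset.sum_nonneg fun _ _ => norm_nonneg _),
          Finset.mul_sum]
        congr 1
        refine Finset.sum_congr rfl fun j hj => ?_
        rw [hu.norm_coord_sum hN, (Finset.mem_filter.1 hj).2, (Finset.mem_filter.1 hF).2]
    _ ≤ weight s a n ^ p * 1 := by
        refine mul_le_mul_of_nonneg_left ?_ (Real.rpow_nonneg (weight_nonneg n) _)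
        refine (hB.sum_family_le hp (u n) _ _ (fun F hF => ?_) fun F hF G hG hne => ?_).trans
          (Real.rpow_le_one (norm_nonneg _) (hu1 n) (by linarith))
        · exact (hC.mem_schreier F (Finset.mem_filter.1 hF).1).subset headPart_subset
        · exact (hC.consecutive F (Finset.mem_filter.1 hF).1 G (Finset.mem_filter.1 hG).1 hne).imp
            (fun h m hm n hn => h m (headPart_subset hm) n (headPart_subset hn))
            fun h m hm n hn => h m (headPart_subset hm) n (headPart_subset hn)
    _ = _ := mul_one _

theorem sum_le_of_tailPart (hB : B.IsBaernsteinNorm p) (hp : 1 ≤ p) (hN : StrictMono N)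
    (hu : B.IsBlock N u) (hu1 : ∀ n, ‖u n‖ ≤ 1) (s : Finset ℕ) (a : ℕ → 𝕜)
    {C : Finset (Finset ℕ)} (hC : IsSchreierChain C) {K : ℝ} (hs : ∑ n ∈ s, ‖a n‖ ^ p ≤ K)
    (htail : ∑ F ∈ C, (∑ j ∈ tailPart N F, ‖B.coord j (∑ n ∈ s, a n • u n)‖) ^ p ≤ K) :
    ∑ F ∈ C, (∑ j ∈ F, ‖B.coord j (∑ n ∈ s, a n • u n)‖) ^ p ≤ 2 ^ p * K := by
  have h1 := hB.sum_headPart_le hp hN hu hu1 s a hC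
  calc _ ≤ ∑ F ∈ C, 2 ^ (p - 1) *
        ((∑ j ∈ headPart N F, ‖B.coord j (∑ n ∈ s, a n • u n)‖) ^ p +
        (∑ j ∈ tailPart N F, ‖B.coord j (∑ n ∈ s, a n • u n)‖) ^ p) := by
        refine Finset.sum_le_sum fun F _ => ?_
        rw [← sum_headPart_add_sum_tailPart (N := N)]
        exact real_rpow_add_le_mul_rpow_add_rpow (Finset.sum_nonneg fun _ _ => norm_nonneg _)
          (Finset.sum_nonneg fun _ _ => norm_nonneg _) hp
    _ ≤ 2 ^ (p - 1) * (K + K) := by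
        rw [← Finset.mul_sum, Finset.sum_add_distrib]
        gcongr
        exact h1.trans hs
    _ = 2 ^ p * K := by
        rw [Real.rpow_sub_one two_ne_zero]
        ring

/-- The upper `ℓ_p` estimate for flat blocks. A tail has mass at most the largest weight it meets,
and different tails meet different intervals, so no weight is counted twice. -/
theorem sum_le_of_small (hB : B.IsBaernsteinNorm p) (hp : 1 ≤ p) (hN : StrictMono N)
    (hu : B.IsBlock N u) (hu1 : ∀ n, ‖u n‖ ≤ 1) (hs : ∀ n j, N n * ‖B.coord j (u n)‖ ≤ 1)
    (s : Finset ℕ) (a : ℕ → 𝕜) {C : Finset (Finset ℕ)} (hC : IsSchreierChain C) :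
    ∑ F ∈ C, (∑ j ∈ F, ‖B.coord j (∑ n ∈ s, a n • u n)‖) ^ p ≤ 2 ^ p * ∑ n ∈ s, ‖a n‖ ^ p := by
  refine hB.sum_le_of_tailPart hp hN hu hu1 s a hC le_rfl ?_
  calc _ ≤ ∑ F ∈ C, ∑ n ∈ (tailPart N F).image (blockIndex N), weight s a n ^ p := by
        refine Finset.sum_le_sum fun F hF => ?_
        rcases (tailPart N F).eq_empty_or_nonempty with h | h
        · simp [h, Real.zero_rpow (show p ≠ 0 by linarith)]
        obtain ⟨m, hm, hmax⟩ := Finset.exists_max_image _ (weight s a) (h.image (blockIndex N))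
        refine le_trans ?_ (Finset.single_le_sum
          (fun n _ => Real.rpow_nonneg (weight_nonneg (s := s) (a := a) n) p) hm)
        refine Real.rpow_le_rpow (Finset.sum_nonneg fun _ _ => norm_nonneg _) ?_ (by linarith)
        calc _ ≤ ∑ j ∈ tailPart N F, weight s a m * ‖B.coord j (u (blockIndex N j))‖ := by
              refine Finset.sum_le_sum fun j hj => ?_
              rw [hu.norm_coord_sum hN]
              exact mul_le_mul_of_nonneg_right (hmax _ (Finset.mem_image_of_mem _ hj))
                (norm_nonneg _)
          _ ≤ weight s a m * 1 := by
              rw [← Finset.mul_sum]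
              exact mul_le_mul_of_nonneg_left
                (sum_tailPart_le_one hN hs (hC.mem_schreier F hF)) (weight_nonneg m)
          _ = _ := mul_one _
    _ = ∑ n ∈ C.biUnion fun F => (tailPart N F).image (blockIndex N), weight s a n ^ p := by
        refine (Finset.sum_biUnion fun F hF G hG hne => ?_).symm
        refine Finset.disjoint_left.2 fun n hn hn' => ?_
        obtain ⟨i, hi, rfl⟩ := Finset.mem_image.1 hn
        obtain ⟨j, hj, hij⟩ := Finset.mem_image.1 hn'
        rcases hC.consecutive F hF G hG hne with h | h
        · exact (blockIndex_lt_of_tailPart hN h hi hj).ne' hij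
        · exact (blockIndex_lt_of_tailPart hN (fun m hm n hn => h n hn m hm) hj hi).ne hij
    _ ≤ _ := sum_weight_rpow_le hp _

/-- The lower `ℓ_p` estimate for arbitrary blocks: chains norming the `v n` up to the factor `1 /
2`, cut down to their intervals, fit together into one chain. -/
theorem sum_rpow_le (hB : B.IsBaernsteinNorm p) (hp : 1 ≤ p) (hN : StrictMono N)
    (hv : B.IsBlock N v) (hv1 : ∀ n, 1 ≤ ‖v n‖) (s : Finset ℕ) (a : ℕ → 𝕜) :
    ∑ n ∈ s, ‖a n‖ ^ p ≤ (2 * ‖∑ n ∈ s, a n • v n‖) ^ p := by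
  have h : ∀ n, ∃ C, IsSchreierChain C ∧
      (1 / 2 : ℝ) ^ p < ∑ F ∈ C, (∑ j ∈ F, ‖B.coord j (v n)‖) ^ p := fun n => by
    by_contra! hcon
    linarith [hB.norm_le (v n) (1 / 2) (by norm_num) hcon, hv1 n]
  choose C hC hCv using h
  have h1 := hB.sum_family_le hp (∑ n ∈ s, a n • v n) (s.sigma C)
    (fun i => i.2.filter fun j => blockIndex N j = i.1)
    (fun i hi => ((hC i.1).mem_schreier _ (Finset.mem_sigma.1 hi).2).subset
      (Finset.filter_subset _ _)) (by
      rintro ⟨n, F⟩ hF ⟨n', F'⟩ hF' hne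
      simp only [Finset.mem_sigma, Finset.mem_filter] at *
      rcases lt_trichotomy n n' with h | rfl | h
      · refine Or.inl fun i hi j hj => ?_
        have := lt_of_blockIndex_lt hN (hi.2.trans_lt (h.trans_eq hj.2.symm))
        omega
      · refine ((hC n).consecutive F hF.2 F' hF'.2 fun h => hne (h ▸ rfl)).imp ?_ ?_
        · exact fun h i hi j hj => h i hi.1 j hj.1
        · exact fun h i hi j hj => h i hi.1 j hj.1
      · refine Or.inr fun i hi j hj => ?_
        have := lt_of_blockIndex_lt hN (hj.2.trans_lt (h.trans_eq hi.2.symm))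
        omega)
  rw [Finset.sum_sigma] at h1
  have h2 : ∀ n ∈ s, ‖a n‖ ^ p * (1 / 2) ^ p ≤ ∑ F ∈ C n,
      (∑ j ∈ F.filter (fun j => blockIndex N j = n),
        ‖B.coord j (∑ n ∈ s, a n • v n)‖) ^ p := fun n hn => by
    calc _ ≤ ‖a n‖ ^ p * ∑ F ∈ C n, (∑ j ∈ F, ‖B.coord j (v n)‖) ^ p :=
          mul_le_mul_of_nonneg_left (hCv n).le (by positivity)
      _ = _ := by
          rw [Finset.mul_sum]
          refine Finset.sum_congr rfl fun F _ => ?_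
          rw [← Real.mul_rpow (norm_nonneg _) (Finset.sum_nonneg fun _ _ => norm_nonneg _),
            Finset.mul_sum, Finset.sum_filter]
          congr 1
          refine Finset.sum_congr rfl fun j _ => ?_
          split_ifs with hj
          · rw [hv.norm_coord_sum hN, hj, weight, if_pos hn]
          · rw [hv n j fun h => hj (blockIndex_eq hN h), norm_zero, mul_zero]
  have h3 := (Finset.sum_le_sum h2).trans h1
  rw [← Finset.sum_mul, one_div, Real.inv_rpow zero_le_two, ← div_eq_mul_inv,
    div_le_iff₀ (by positivity)] at h3
  rwa [mul_comm 2, Real.mul_rpow (norm_nonneg _) zero_le_two]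

theorem isSchreierLike (hB : B.IsBaernsteinNorm p) (hp : 1 < p) : B.IsSchreierLike where
  norm_sum_le_of_coord N u v hN hu hv hu1 hv1 s a := by
    obtain ⟨k, hk, hk1⟩ := hv.exists_peaks hv1
    have hA := hB.sum_rpow_le hp.le hN hv
      (fun n => (hk1 n).trans (B.norm_coord_le (k n) (v n))) s a
    refine hB.norm_le _ _ (by positivity) fun C hC => ?_
    refine (hB.sum_le_of_tailPart hp.le hN hu hu1 s a hC hA ?_).trans_eq ?_
    -- The tail of each chain member is replaced by the peaks of `v` in the intervals it meets;
    -- these peak sets are again consecutive Schreier sets.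
    · calc _ ≤ ∑ F ∈ C, (∑ j ∈ ((tailPart N F).image (blockIndex N)).image k,
            ‖B.coord j (∑ n ∈ s, a n • v n)‖) ^ p := by
            refine Finset.sum_le_sum fun F hF => Real.rpow_le_rpow
              (Finset.sum_nonneg fun _ _ => norm_nonneg _) ?_ (by linarith)
            rw [← Finset.sum_fiberwise_of_maps_to (t := (tailPart N F).image (blockIndex N))
              (fun j hj => Finset.mem_image_of_mem _ hj),
              Finset.sum_image ((injective_of_mem_Ico hN hk).injOn)]
            refine Finset.sum_le_sum fun n _ => ?_
            refine le_trans ?_ (hv.weight_le_norm_coord hN hk hk1 s a n)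
            calc _ = weight s a n * ∑ j ∈ (tailPart N F).filter (fun j => blockIndex N j = n),
                  ‖B.coord j (u n)‖ := by
                  rw [Finset.mul_sum]
                  refine Finset.sum_congr rfl fun j hj => ?_
                  rw [hu.norm_coord_sum hN, (Finset.mem_filter.1 hj).2]
              _ ≤ weight s a n * 1 := by
                  refine mul_le_mul_of_nonneg_left ?_ (weight_nonneg n)
                  exact (hB.sum_schreier_le hp.le (u n) (((hC.mem_schreier F hF).subset
                    tailPart_subset).subset (Finset.filter_subset _ _))).trans (hu1 n)
              _ = _ := mul_one _
        _ ≤ ‖∑ n ∈ s, a n • v n‖ ^ p := by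
            refine hB.sum_family_le hp.le _ C _ (fun F hF => isSchreier_image_tailPart hN
              (hC.mem_schreier F hF) fun n => (Finset.mem_Ico.1 (hk n)).1)
              fun F hF G hG hne => ?_
            have key : ∀ {F G : Finset ℕ}, (∀ m ∈ F, ∀ n ∈ G, m < n) →
                ∀ m ∈ ((tailPart N F).image (blockIndex N)).image k,
                ∀ n ∈ ((tailPart N G).image (blockIndex N)).image k, m < n := by
              intro F G h m hm n hn
              simp only [Finset.mem_image, exists_exists_and_eq_and] at hm hn
              obtain ⟨i, hi, rfl⟩ := hm
              obtain ⟨j, hj, rfl⟩ := hn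
              have h1 := blockIndex_lt_of_tailPart hN h hi hj
              have h2 := Finset.mem_Ico.1 (hk (blockIndex N i))
              have h3 := Finset.mem_Ico.1 (hk (blockIndex N j))
              have h4 : N (blockIndex N i + 1) ≤ N (blockIndex N j) := hN.monotone h1
              omega
            exact (hC.consecutive F hF G hG hne).imp key
              fun h m hm n hn => key (fun m hm n hn => h n hn m hm) n hn m hm
        _ ≤ _ := Real.rpow_le_rpow (norm_nonneg _)
            (by linarith [norm_nonneg (∑ n ∈ s, a n • v n)]) (by linarith)
    · rw [← Real.mul_rpow zero_le_two (by positivity)]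
      ring_nf
  norm_sum_le_of_small N u v hN hu hv hu1 hs hv1 s a := by
    refine hB.norm_le _ _ (by positivity) fun C hC => ?_
    refine (hB.sum_le_of_small hp.le hN hu hu1 hs s a hC).trans ?_
    calc _ ≤ 2 ^ p * (2 * ‖∑ n ∈ s, a n • v n‖) ^ p := by
          gcongr
          exact hB.sum_rpow_le hp.le hN hv hv1 s a
      _ = _ := by
          rw [← Real.mul_rpow zero_le_two (by positivity)]
          ring_nf
  exists_norm_sum_le η hη := by
    -- Sums of `k` flat blocks have norm at most `2 * k ^ (1 / p)`, which is small compared with `k`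
    -- precisely because `1 < p`.
    have hlim : Tendsto (fun k : ℕ => (2 : ℝ) * (k : ℝ) ^ (-(1 - 1 / p))) atTop (𝓝 0) := by
      have h1 : 0 < 1 - 1 / p := by
        rw [sub_pos, div_lt_one (by linarith)]
        exact hp
      simpa using ((tendsto_rpow_neg_atTop h1).comp tendsto_natCast_atTop_atTop).const_mul 2
    obtain ⟨k, hk, hk0⟩ := ((hlim.eventually_lt_const hη).and (eventually_gt_atTop 0)).exists
    have hk0' : (0 : ℝ) < k := by exact_mod_cast hk0
    refine ⟨k, hk0, fun N u hN hu hu1 hs => ?_⟩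
    have h : ‖∑ n ∈ Finset.range k, (1 : 𝕜) • u n‖ ≤ 2 * (k : ℝ) ^ (1 / p) := by
      refine hB.norm_le _ _ (by positivity) fun C hC => ?_
      refine (hB.sum_le_of_small hp.le hN hu hu1 hs _ (fun _ => (1 : 𝕜)) hC).trans_eq ?_
      rw [Real.mul_rpow zero_le_two (by positivity), one_div,
        Real.rpow_inv_rpow hk0'.le (by linarith)]
      simp
    simp only [one_smul] at h
    refine h.trans ?_
    calc _ = 2 * (k : ℝ) ^ (-(1 - 1 / p)) * k := by
          rw [mul_assoc, ← Real.rpow_add_one hk0'.ne']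
          congr 2
          ring
      _ ≤ η * k := by gcongr

end UnitBasis.IsBaernsteinNorm

/-! ### Completeness -/

/-- Spaces of sequences normed by a supremum of continuous seminorms are complete. -/
theorem completeSpace_of_iSup_seminorm {𝕜 E ι : Type*} [RCLike 𝕜] [NormedAddCommGroup E]
    [NormedSpace 𝕜 E] (f : E →ₗ[𝕜] (ℕ → 𝕜)) (q : ι → Seminorm 𝕜 (ℕ → 𝕜))
    (hq : ∀ i, Continuous (q i)) (hcoord : ∀ x n, ‖f x n‖ ≤ ‖x‖)
    (hnorm : ∀ x c, 0 ≤ c → (‖x‖ ≤ c ↔ ∀ i, q i (f x) ≤ c))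
    (hmem : ∀ (y : ℕ → 𝕜) (c : ℝ), (∀ i, q i y ≤ c) → ∃ x, f x = y) : CompleteSpace E := by
  refine Metric.complete_of_cauchySeq_tendsto fun x hx => ?_
  have hlim : ∀ n, ∃ y, Tendsto (fun k => f (x k) n) atTop (𝓝 y) := fun n => by
    refine cauchySeq_tendsto_of_complete (Metric.cauchySeq_iff'.2 fun ε hε => ?_)
    obtain ⟨K, hK⟩ := Metric.cauchySeq_iff'.1 hx ε hε
    refine ⟨K, fun k hk => lt_of_le_of_lt ?_ (hK k hk)⟩
    rw [dist_eq_norm, dist_eq_norm, ← Pi.sub_apply, ← map_sub]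
    exact hcoord _ n
  choose y hy using hlim
  have hy' : Tendsto (fun k => f (x k)) atTop (𝓝 y) := tendsto_pi_nhds.2 hy
  -- Each seminorm is continuous for coordinatewise convergence, so the Cauchy estimate passes to
  -- the limit in `l`, uniformly in `i`.
  have key : ∀ ε > 0, ∃ K, ∀ k ≥ K, ∀ i, q i (f (x k) - y) ≤ ε := fun ε hε => by
    obtain ⟨K, hK⟩ := Metric.cauchySeq_iff.1 hx ε hε
    refine ⟨K, fun k hk i => ?_⟩
    have h1 : Tendsto (fun l => q i (f (x k) - f (x l))) atTop (𝓝 (q i (f (x k) - y))) :=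
      ((hq i).tendsto _).comp (hy'.const_sub _)
    refine le_of_tendsto h1 ?_
    filter_upwards [eventually_ge_atTop K] with l hl
    rw [← map_sub]
    refine (hnorm _ ε hε.le).1 ?_ i
    rw [← dist_eq_norm]
    exact (hK k hk l hl).le
  obtain ⟨z, hz⟩ : ∃ z, f z = y := by
    obtain ⟨K, hK⟩ := key 1 one_pos
    refine hmem y (‖x K‖ + 1) fun i => ?_
    have h1 := map_sub_le_add (q i) (f (x K)) (f (x K) - y)
    rw [sub_sub_cancel] at h1
    linarith [(hnorm (x K) _ (norm_nonneg _)).1 le_rfl i, hK K le_rfl i]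
  refine ⟨z, Metric.tendsto_atTop.2 fun ε hε => ?_⟩
  obtain ⟨K, hK⟩ := key (ε / 2) (half_pos hε)
  refine ⟨K, fun k hk => lt_of_le_of_lt ?_ (half_lt_self hε)⟩
  rw [dist_eq_norm, hnorm _ _ (by positivity)]
  intro i
  rw [map_sub, hz]
  exact hK k hk i

/-! ### Bounds and continuity of the defining seminorms -/

section Monotone

variable {𝕜 : Type*} [RCLike 𝕜] {p : ℝ}

theorem mu_le_iff (hp : 1 ≤ p) (F : Finset ℕ) (x : ℕ → 𝕜) {c : ℝ} (hc : 0 ≤ c) :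
    mu p F x ≤ c ↔ ∑ n ∈ F, ‖x n‖ ^ p ≤ c ^ p := by
  rw [mu, one_div]
  exact Real.rpow_inv_le_iff_of_pos (Finset.sum_nonneg fun _ _ => by positivity) hc (by linarith)

theorem beta_le_iff (hp : 1 ≤ p) (C : Finset (Finset ℕ)) (x : ℕ → 𝕜) {c : ℝ} (hc : 0 ≤ c) :
    beta p C x ≤ c ↔ ∑ F ∈ C, (∑ n ∈ F, ‖x n‖) ^ p ≤ c ^ p := by
  rw [beta, one_div]
  exact Real.rpow_inv_le_iff_of_pos (Finset.sum_nonneg fun _ _ => by positivity) hc (by linarith)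

theorem continuous_mu (hp : 1 ≤ p) (F : Finset ℕ) : Continuous fun x : ℕ → 𝕜 => mu p F x := by
  have hp0 : 0 ≤ p := by linarith
  unfold mu
  refine Continuous.rpow_const (continuous_finsetSum _ fun n _ => ?_) fun _ => Or.inr (by positivity)
  exact ((continuous_apply n).norm).rpow_const fun _ => Or.inr hp0

theorem continuous_beta (hp : 1 ≤ p) (C : Finset (Finset ℕ)) :
    Continuous fun x : ℕ → 𝕜 => beta p C x := by
  have hp0 : 0 ≤ p := by linarith
  unfold beta
  refine Continuous.rpow_const (continuous_finsetSum _ fun F _ => ?_) fun _ => Or.inr (by positivity)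
  exact (continuous_finsetSum _ fun n _ => (continuous_apply n).norm).rpow_const
    fun _ => Or.inr hp0

end Monotone

section Spaces

variable (𝕜 : Type*) [RCLike 𝕜] (p : ℝ) [hp : Fact (1 ≤ p)]

/-! ### The Schreier space -/

/-- The inclusion of `Z_p` into the space of all sequences. -/
def zSeq : ZSpace 𝕜 p →ₗ[𝕜] (ℕ → 𝕜) := Submodule.subtype (finiteSup (muSeminorm 𝕜 p))

variable {𝕜 p}

theorem zSpace_norm_le_iff (x : ZSpace 𝕜 p) {c : ℝ} :
    ‖x‖ ≤ c ↔ ∀ F : {F : Finset ℕ // IsSchreier F}, mu p F.1 (zSeq 𝕜 p x) ≤ c :=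
  ⟨fun h F => (le_ciSup (f := fun F => muSeminorm 𝕜 p F x.1) x.2 F).trans h,
    fun h => ciSup_le (f := fun F => muSeminorm 𝕜 p F x.1) h⟩

theorem zSpace_norm_coord_le (x : ZSpace 𝕜 p) (n : ℕ) : ‖zSeq 𝕜 p x n‖ ≤ ‖x‖ := by
  rw [← mu_singleton hp.out n (zSeq 𝕜 p x)]
  exact (zSpace_norm_le_iff x).1 le_rfl ⟨{n}, isSchreier_singleton n⟩

instance : CompleteSpace (ZSpace 𝕜 p) :=
  completeSpace_of_iSup_seminorm (zSeq 𝕜 p) (muSeminorm 𝕜 p) (fun F => continuous_mu hp.out F.1)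
    zSpace_norm_coord_le (fun x _ _ => zSpace_norm_le_iff x)
    fun y c hy => ⟨⟨y, c, by rintro _ ⟨F, rfl⟩; exact hy F⟩, rfl⟩

theorem zSpace_norm_le_norm {x y : ZSpace 𝕜 p} (h : ∀ n, ‖zSeq 𝕜 p x n‖ ≤ ‖zSeq 𝕜 p y n‖) :
    ‖x‖ ≤ ‖y‖ := by
  have hp0 : 0 ≤ p := by linarith [hp.out]
  refine (zSpace_norm_le_iff x).2 fun F => le_trans ?_ ((zSpace_norm_le_iff y).1 le_rfl F)
  refine Real.rpow_le_rpow (Finset.sum_nonneg fun _ _ => by positivity) ?_ (by positivity)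
  exact Finset.sum_le_sum fun n _ => Real.rpow_le_rpow (norm_nonneg _) (h n) hp0

variable (𝕜 p) in
/-- The coordinate functionals of `Z_p`. -/
def zCoord (n : ℕ) : ZSpace 𝕜 p →L[𝕜] 𝕜 :=
  (LinearMap.proj n ∘ₗ zSeq 𝕜 p).mkContinuous 1 fun x => by
    simpa using zSpace_norm_coord_le x n

theorem zCoord_apply (n : ℕ) (x : ZSpace 𝕜 p) : zCoord 𝕜 p n x = zSeq 𝕜 p x n := rfl

theorem zCoord_unitVec (m n : ℕ) : zCoord 𝕜 p m (unitVec 𝕜 p n) = if m = n then 1 else 0 :=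
  Pi.single_apply n 1 m

theorem zSeq_sum_unitVec (N : ℕ) (x : ZSpace 𝕜 p) (j : ℕ) :
    zSeq 𝕜 p (∑ i ∈ Finset.range N, zCoord 𝕜 p i x • unitVec 𝕜 p i) j =
      if j < N then zSeq 𝕜 p x j else 0 := by
  rw [← zCoord_apply]
  simp [zCoord_unitVec, ← zCoord_apply]

theorem tendsto_sum_unitVec {x : ZSpace 𝕜 p}
    (hx : x ∈ (Submodule.span 𝕜 (Set.range (unitVec 𝕜 p))).topologicalClosure) :
    Tendsto (fun N => ∑ i ∈ Finset.range N, zCoord 𝕜 p i x • unitVec 𝕜 p i) atTop (𝓝 x) := by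
  have hspan : ∀ z ∈ Submodule.span 𝕜 (Set.range (unitVec 𝕜 p)), ∃ M, ∀ j ≥ M,
      zSeq 𝕜 p z j = 0 := fun z hz => by
    induction hz using Submodule.span_induction with
    | mem z hz =>
      obtain ⟨n, rfl⟩ := hz
      refine ⟨n + 1, fun j hj => ?_⟩
      rw [← zCoord_apply, zCoord_unitVec, if_neg (by omega)]
    | zero => exact ⟨0, fun j _ => by simp⟩
    | add y z _ _ hy hz =>
      obtain ⟨M, hM⟩ := hy
      obtain ⟨M', hM'⟩ := hz
      refine ⟨max M M', fun j hj => ?_⟩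
      rw [map_add, Pi.add_apply, hM j (le_of_max_le_left hj), hM' j (le_of_max_le_right hj),
        add_zero]
    | smul c z _ hz =>
      obtain ⟨M, hM⟩ := hz
      refine ⟨M, fun j hj => ?_⟩
      rw [map_smul, Pi.smul_apply, hM j hj, smul_zero]
  refine Metric.tendsto_atTop.2 fun ε hε => ?_
  obtain ⟨z, hz, hxz⟩ := Metric.mem_closure_iff.1 hx ε hε
  obtain ⟨M, hM⟩ := hspan z hz
  refine ⟨M, fun N hN => lt_of_le_of_lt ?_ hxz⟩
  rw [dist_comm, dist_eq_norm, dist_eq_norm]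
  -- The approximant `z` vanishes from `M` on, so the remainder of `x` is coordinatewise dominated
  -- by `x - z`.
  refine zSpace_norm_le_norm fun j => ?_
  rw [map_sub, map_sub, Pi.sub_apply, Pi.sub_apply, zSeq_sum_unitVec]
  split_ifs with hj
  · simp
  · rw [hM j (by omega)]

variable (𝕜 p) in
/-- The unit vector basis of the Schreier space. -/
def schreierBasis : UnitBasis 𝕜 (SchreierSpace 𝕜 p) where
  coord n := zCoord 𝕜 p n ∘L Submodule.subtypeL _
  vec n := ⟨unitVec 𝕜 p n, Submodule.le_topologicalClosure _ (Submodule.subset_span ⟨n, rfl⟩)⟩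
  coord_vec m n := zCoord_unitVec (𝕜 := 𝕜) (p := p) m n
  norm_coord_le n x := zSpace_norm_coord_le x.1 n
  norm_le_norm x y h := zSpace_norm_le_norm h
  tendsto_sum x := by
    rw [tendsto_subtype_rng]
    simpa using tendsto_sum_unitVec x.2

theorem isSchreierNorm_schreierBasis : (schreierBasis 𝕜 p).IsSchreierNorm p where
  sum_le x F hF := (mu_le_iff hp.out F (zSeq 𝕜 p x.1) (norm_nonneg x)).1
    ((zSpace_norm_le_iff x.1).1 le_rfl ⟨F, hF⟩)
  norm_le x _ hc h := (zSpace_norm_le_iff x.1).2 fun F =>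
    (mu_le_iff hp.out F.1 (zSeq 𝕜 p x.1) hc).2 (h F.1 F.2)

/-! ### The Baernstein space -/

variable (𝕜 p) in
/-- The inclusion of `B_p` into the space of all sequences. -/
def baernsteinSeq : BaernsteinSpace 𝕜 p →ₗ[𝕜] (ℕ → 𝕜) :=
  Submodule.subtype (finiteSup (betaSeminorm 𝕜 p))

theorem baernstein_norm_le_iff (x : BaernsteinSpace 𝕜 p) {c : ℝ} :
    ‖x‖ ≤ c ↔ ∀ C : {C : Finset (Finset ℕ) // IsSchreierChain C},
      beta p C.1 (baernsteinSeq 𝕜 p x) ≤ c :=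
  ⟨fun h C => (le_ciSup (f := fun C => betaSeminorm 𝕜 p C x.1) x.2 C).trans h,
    fun h => ciSup_le (f := fun C => betaSeminorm 𝕜 p C x.1) h⟩

theorem baernstein_sum_le (x : BaernsteinSpace 𝕜 p) {C : Finset (Finset ℕ)}
    (hC : IsSchreierChain C) :
    ∑ F ∈ C, (∑ n ∈ F, ‖baernsteinSeq 𝕜 p x n‖) ^ p ≤ ‖x‖ ^ p :=
  (beta_le_iff hp.out C _ (norm_nonneg x)).1 ((baernstein_norm_le_iff x).1 le_rfl ⟨C, hC⟩)

theorem baernstein_norm_le {x : BaernsteinSpace 𝕜 p} {c : ℝ} (hc : 0 ≤ c)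
    (h : ∀ C, IsSchreierChain C → ∑ F ∈ C, (∑ n ∈ F, ‖baernsteinSeq 𝕜 p x n‖) ^ p ≤ c ^ p) :
    ‖x‖ ≤ c :=
  (baernstein_norm_le_iff x).2 fun C => (beta_le_iff hp.out C.1 _ hc).2 (h C.1 C.2)

theorem baernstein_norm_coord_le (x : BaernsteinSpace 𝕜 p) (n : ℕ) :
    ‖baernsteinSeq 𝕜 p x n‖ ≤ ‖x‖ := by
  rw [← beta_singleton hp.out n (baernsteinSeq 𝕜 p x)]
  exact (baernstein_norm_le_iff x).1 le_rfl ⟨{{n}}, isSchreierChain_singleton n⟩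

instance : CompleteSpace (BaernsteinSpace 𝕜 p) :=
  completeSpace_of_iSup_seminorm (baernsteinSeq 𝕜 p) (betaSeminorm 𝕜 p)
    (fun C => continuous_beta hp.out C.1)
    baernstein_norm_coord_le (fun x _ _ => baernstein_norm_le_iff x)
    fun y c hy => ⟨⟨y, c, by rintro _ ⟨F, rfl⟩; exact hy F⟩, rfl⟩

theorem baernstein_norm_le_norm {x y : BaernsteinSpace 𝕜 p}
    (h : ∀ n, ‖baernsteinSeq 𝕜 p x n‖ ≤ ‖baernsteinSeq 𝕜 p y n‖) : ‖x‖ ≤ ‖y‖ := by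
  have hp0 : 0 ≤ p := by linarith [hp.out]
  refine baernstein_norm_le (norm_nonneg _) fun C hC => le_trans ?_ (baernstein_sum_le y hC)
  exact Finset.sum_le_sum fun F _ => Real.rpow_le_rpow
    (Finset.sum_nonneg fun _ _ => norm_nonneg _) (Finset.sum_le_sum fun n _ => h n) hp0

variable (𝕜 p) in
theorem single_mem_finiteSup_beta (n : ℕ) :
    (Pi.single n 1 : ℕ → 𝕜) ∈ finiteSup (betaSeminorm 𝕜 p) := by
  have hp0 : p ≠ 0 := by linarith [hp.out]
  refine ⟨1, ?_⟩
  rintro _ ⟨⟨C, hC⟩, rfl⟩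
  refine (beta_le_iff hp.out C _ zero_le_one).2 ?_
  have h : ∀ F : Finset ℕ, (∑ m ∈ F, ‖(Pi.single n 1 : ℕ → 𝕜) m‖) ^ p =
      if n ∈ F then 1 else 0 := fun F => by
    have h1 : ∀ m, ‖(Pi.single n 1 : ℕ → 𝕜) m‖ = if n = m then 1 else 0 := fun m => by
      rw [Pi.single_apply]
      by_cases hm : m = n
      · simp [hm]
      · simp [hm, Ne.symm hm]
    simp only [h1, Finset.sum_ite_eq]
    split_ifs
    exacts [Real.one_rpow p, Real.zero_rpow hp0]
  simp only [h, Real.one_rpow]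
  rw [← Finset.sum_filter, Finset.sum_const, nsmul_eq_mul, mul_one]
  -- Members of a chain are disjoint, so at most one contains `n`.
  have h2 : (C.filter fun F => n ∈ F).card ≤ 1 := Finset.card_le_one.2 fun F hF G hG => by
    rw [Finset.mem_filter] at hF hG
    by_contra hne
    rcases hC.consecutive F hF.1 G hG.1 hne with h | h <;>
      exact lt_irrefl _ (h n hF.2 n hG.2)
  exact_mod_cast h2

variable (𝕜 p) in
/-- The unit vectors of `B_p`. -/
def baernsteinVec (n : ℕ) : BaernsteinSpace 𝕜 p :=
  ⟨Pi.single n 1, single_mem_finiteSup_beta 𝕜 p n⟩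

variable (𝕜 p) in
/-- The coordinate functionals of `B_p`. -/
def baernsteinCoord (n : ℕ) : BaernsteinSpace 𝕜 p →L[𝕜] 𝕜 :=
  (LinearMap.proj n ∘ₗ baernsteinSeq 𝕜 p).mkContinuous 1 fun x => by
    simpa using baernstein_norm_coord_le x n

theorem baernsteinCoord_apply (n : ℕ) (x : BaernsteinSpace 𝕜 p) :
    baernsteinCoord 𝕜 p n x = baernsteinSeq 𝕜 p x n := rfl

theorem baernsteinCoord_vec (m n : ℕ) :
    baernsteinCoord 𝕜 p m (baernsteinVec 𝕜 p n) = if m = n then 1 else 0 :=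
  Pi.single_apply n 1 m

theorem baernsteinSeq_sum_vec (N : ℕ) (x : BaernsteinSpace 𝕜 p) (j : ℕ) :
    baernsteinSeq 𝕜 p (∑ i ∈ Finset.range N, baernsteinCoord 𝕜 p i x • baernsteinVec 𝕜 p i) j =
      if j < N then baernsteinSeq 𝕜 p x j else 0 := by
  rw [← baernsteinCoord_apply]
  simp [baernsteinCoord_vec, ← baernsteinCoord_apply]

/-- A chain that almost attains the norm of `x` leaves little room beyond its last element. -/
theorem exists_tail_norm_le (x : BaernsteinSpace 𝕜 p) {ε : ℝ} (hε : 0 < ε) :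
    ∃ M : ℕ, ∀ y : BaernsteinSpace 𝕜 p,
      (∀ j, ‖baernsteinSeq 𝕜 p y j‖ ≤ if j < M then 0 else ‖baernsteinSeq 𝕜 p x j‖) →
      ‖y‖ ≤ ε := by
  have hp1 : 1 ≤ p := hp.out
  have hp0 : 0 < p := by linarith
  obtain ⟨C, hC, hCx⟩ : ∃ C, IsSchreierChain C ∧
      ‖x‖ ^ p - ε ^ p < ∑ F ∈ C, (∑ n ∈ F, ‖baernsteinSeq 𝕜 p x n‖) ^ p := by
    by_contra! hcon
    have h0 : 0 ≤ ‖x‖ ^ p - ε ^ p := le_trans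
      (Finset.sum_nonneg fun F _ => by positivity) (hcon _ (isSchreierChain_singleton 0))
    have h1 : ‖x‖ ≤ (‖x‖ ^ p - ε ^ p) ^ p⁻¹ := baernstein_norm_le (by positivity) fun C hC => by
      rw [Real.rpow_inv_rpow h0 hp0.ne']
      exact hcon C hC
    have h2 := Real.rpow_le_rpow (norm_nonneg _) h1 hp0.le
    rw [Real.rpow_inv_rpow h0 hp0.ne'] at h2
    linarith [Real.rpow_pos_of_pos hε p]
  refine ⟨(C.biUnion id).sup id + 1, fun y hy => baernstein_norm_le hε.le fun D hD => ?_⟩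
  set M := (C.biUnion id).sup id + 1 with hM
  have hlt : ∀ F ∈ C, ∀ m ∈ F, m < M := fun F hF m hm =>
    Nat.lt_succ_of_le (Finset.le_sup (f := id) (Finset.mem_biUnion.2 ⟨F, hF, hm⟩))
  -- The parts of `D` beyond `M` are appended to `C`. The combined sum is at most `‖x‖ ^ p`, and `C`
  -- already uses all but `ε ^ p` of it.
  have h1 := sum_family_le hp1 (fun n => ‖baernsteinSeq 𝕜 p x n‖) (by positivity)
    (fun C hC => baernstein_sum_le x hC) (C.disjSum D)
    (Sum.elim id fun F => F.filter fun j => M ≤ j) (by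
      rintro (F | F) hF
      · exact hC.mem_schreier F (Finset.inl_mem_disjSum.1 hF)
      · exact (hD.mem_schreier F (Finset.inr_mem_disjSum.1 hF)).subset (Finset.filter_subset _ _))
    (by
      rintro (F | F) hF (G | G) hG hne
      · exact hC.consecutive F (Finset.inl_mem_disjSum.1 hF) G (Finset.inl_mem_disjSum.1 hG)
          fun h => hne (h ▸ rfl)
      · exact Or.inl fun m hm n hn => (hlt F (Finset.inl_mem_disjSum.1 hF) m hm).trans_le
          (Finset.mem_filter.1 hn).2
      · exact Or.inr fun m hm n hn => (hlt G (Finset.inl_mem_disjSum.1 hG) n hn).trans_le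
          (Finset.mem_filter.1 hm).2
      · exact (hD.consecutive F (Finset.inr_mem_disjSum.1 hF) G (Finset.inr_mem_disjSum.1 hG)
          fun h => hne (h ▸ rfl)).imp
          (fun h m hm n hn => h m (Finset.mem_filter.1 hm).1 n (Finset.mem_filter.1 hn).1)
          fun h m hm n hn => h m (Finset.mem_filter.1 hm).1 n (Finset.mem_filter.1 hn).1)
  rw [Finset.sum_disjSum] at h1
  simp only [Sum.elim_inl, Sum.elim_inr, id] at h1
  refine le_trans ?_ (show ∑ F ∈ D, (∑ j ∈ F.filter (fun j => M ≤ j),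
    ‖baernsteinSeq 𝕜 p x j‖) ^ p ≤ ε ^ p by linarith)
  refine Finset.sum_le_sum fun F _ => Real.rpow_le_rpow
    (Finset.sum_nonneg fun _ _ => norm_nonneg _) ?_ hp0.le
  rw [Finset.sum_filter]
  refine Finset.sum_le_sum fun j _ => (hy j).trans_eq ?_
  by_cases hj : j < M
  · rw [if_pos hj, if_neg (by omega)]
  · rw [if_neg hj, if_pos (by omega)]

theorem tendsto_sum_baernsteinVec (x : BaernsteinSpace 𝕜 p) :
    Tendsto (fun N => ∑ i ∈ Finset.range N, baernsteinCoord 𝕜 p i x • baernsteinVec 𝕜 p i)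
      atTop (𝓝 x) := by
  refine Metric.tendsto_atTop.2 fun ε hε => ?_
  obtain ⟨M, hM⟩ := exists_tail_norm_le x (half_pos hε)
  refine ⟨M, fun N hN => lt_of_le_of_lt ?_ (half_lt_self hε)⟩
  rw [dist_comm, dist_eq_norm]
  refine hM _ fun j => ?_
  rw [map_sub, Pi.sub_apply, baernsteinSeq_sum_vec]
  by_cases hj : j < N
  · rw [if_pos hj, sub_self, norm_zero]
    split_ifs <;> simp
  · rw [if_neg hj, if_neg (by omega), sub_zero]

variable (𝕜 p) in
/-- The unit vector basis of the Baernstein space. -/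
def baernsteinBasis : UnitBasis 𝕜 (BaernsteinSpace 𝕜 p) where
  coord := baernsteinCoord 𝕜 p
  vec := baernsteinVec 𝕜 p
  coord_vec := baernsteinCoord_vec
  norm_coord_le n x := baernstein_norm_coord_le x n
  norm_le_norm _ _ h := baernstein_norm_le_norm h
  tendsto_sum := tendsto_sum_baernsteinVec

theorem isBaernsteinNorm_baernsteinBasis : (baernsteinBasis 𝕜 p).IsBaernsteinNorm p where
  sum_le x _ hC := baernstein_sum_le x hC
  norm_le _ _ hc h := baernstein_norm_le hc h

end Spaces

end SchreierBaernstein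

end

/-! ### The main theorem -/

theorem theorem1p1 (𝕜 : Type*) [RCLike 𝕜] (p : ℝ) [Fact (1 ≤ p)] :
    -- the Baernstein space `E = B_p`, for `1 < p`
    (1 < p →
      (∀ T U : Op 𝕜 (BaernsteinSpace 𝕜 p),
        IsStrictlySingular T → IsStrictlySingular U → IsCompactOperator (T ∘L U)) ∧
      (∀ I : TwoSidedIdeal (Op 𝕜 (BaernsteinSpace 𝕜 p)),
        IsClosed (I : Set (Op 𝕜 (BaernsteinSpace 𝕜 p))) → IsSmall I → I ≠ ⊥ →
        (∃ l : Filter (Op 𝕜 (BaernsteinSpace 𝕜 p)),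
          IsLeftApproxIdentity (I : Set (Op 𝕜 (BaernsteinSpace 𝕜 p))) l ∨
          IsRightApproxIdentity (I : Set (Op 𝕜 (BaernsteinSpace 𝕜 p))) l) →
        (I : Set (Op 𝕜 (BaernsteinSpace 𝕜 p))) = compactOps 𝕜 (BaernsteinSpace 𝕜 p)) ∧
      (∃ l : Filter (Op 𝕜 (BaernsteinSpace 𝕜 p)),
        IsLeftApproxIdentity (compactOps 𝕜 (BaernsteinSpace 𝕜 p)) l ∧
        IsRightApproxIdentity (compactOps 𝕜 (BaernsteinSpace 𝕜 p)) l ∧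
        ∀ᶠ A in l, ‖A‖ ≤ 1)) ∧
    -- the `p`-convexified Schreier space `E = S_p`, for `1 ≤ p`
    ((∀ T U : Op 𝕜 (SchreierSpace 𝕜 p),
        IsStrictlySingular T → IsStrictlySingular U → IsCompactOperator (T ∘L U)) ∧
      (∀ I : TwoSidedIdeal (Op 𝕜 (SchreierSpace 𝕜 p)),
        IsClosed (I : Set (Op 𝕜 (SchreierSpace 𝕜 p))) → IsSmall I → I ≠ ⊥ →
        (∃ l : Filter (Op 𝕜 (SchreierSpace 𝕜 p)),
          IsLeftApproxIdentity (I : Set (Op 𝕜 (SchreierSpace 𝕜 p))) l ∨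
          IsRightApproxIdentity (I : Set (Op 𝕜 (SchreierSpace 𝕜 p))) l) →
        (I : Set (Op 𝕜 (SchreierSpace 𝕜 p))) = compactOps 𝕜 (SchreierSpace 𝕜 p)) ∧
      (∃ l : Filter (Op 𝕜 (SchreierSpace 𝕜 p)),
        IsLeftApproxIdentity (compactOps 𝕜 (SchreierSpace 𝕜 p)) l ∧
        IsRightApproxIdentity (compactOps 𝕜 (SchreierSpace 𝕜 p)) l ∧
        ∀ᶠ A in l, ‖A‖ ≤ 1)) := by
  refine ⟨fun hp => ?_, ?_⟩
  · have hB := (isBaernsteinNorm_baernsteinBasis (𝕜 := 𝕜) (p := p)).isSchreierLike hp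
    exact ⟨fun T U hT hU => hB.isCompactOperator_comp hT hU,
      fun I hcl hI h0 ⟨l, hl⟩ => hB.eq_compactOps hcl hI h0 hl, hB.exists_approxIdentity⟩
  · have hB := (isSchreierNorm_schreierBasis (𝕜 := 𝕜) (p := p)).isSchreierLike Fact.out
    exact ⟨fun T U hT hU => hB.isCompactOperator_comp hT hU,
      fun I hcl hI h0 ⟨l, hl⟩ => hB.eq_compactOps hcl hI h0 hl, hB.exists_approxIdentity⟩
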